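/- Let $n>p\ge 0$ and $r\ge 1$, let $q_1,\dots,q_r\ge1$ and $q=\sum_{i=1}^r q_i$, let $\mathbf X\in\mathbb R^{n\times p}$ have rank $p$ and let $\mathbf Z\in\mathbb R^{n\times q}$. Let $\Gamma\subset\mathbb R$ be a measurable set, and let $a(\cdot),b(\cdot)$ be positive differentiable functions on $\Gamma$. Write $\phi$ for the standard normal density, and let $\mathrm{TPN}(0,\sigma,\gamma)$ be the two-piece normal distribution with density $$s(u\mid 0,\sigma,\gamma)=\frac{2}{\sigma[a(\gamma)+b(\gamma)]}\left[\phi\!\left(\frac{u}{\sigma b(\gamma)}\right)I(u<0)+\phi\!\left(\frac{u}{\sigma a(\gamma)}\right)I(u\ge 0)\right].$$ Consider the linear mixed model $\mathbf y=\mathbf X\boldsymbol\beta+\mathbf Z\mathbf u+\boldsymbol\varepsilon$, with $\mathbf y\mid\mathbf u,\boldsymbol\beta,\sigma_0\sim N_n(\mathbf X\boldsymbol\beta+\mathbf Z\mathbf u,\sigma_0^2\mathbf I_n)$ and independent $u_{ik}\mid\sigma_i,\gamma_i\sim\mathrm{TPN}(0,\sigma_i,\gamma_i)$ for $k=1,\dots,q_i$,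 $i=1,\dots,r$, where $\mathbf u=(u_{11},\dots,u_{1q_1},\dots,u_{r1},\dots,u_{rq_r})^\top$. The prior is $$\pi(\boldsymbol\beta,\sigma_0,\dots,\sigma_r,\gamma_1,\dots,\gamma_r)\propto\frac{1}{\sigma_0^{2a_0+1}}e^{-b_0/\sigma_0^2}\prod_{i=1}^r\frac{\pi_i(\gamma_i)}{\sigma_i^{2a_i+1}}e^{-b_i/\sigma_i^2},\qquad \boldsymbol\beta\in\mathbb R^p,\ \sigma_i>0,\ \gamma_i\in\Gamma,$$ where $a_0,\dots,a_r,b_0,\dots,b_r$ are real numbers and each $\pi_i(\gamma)\,d\gamma$ is a probability measure on $\Gamma$ (a proper prior, not necessarily absolutely continuous). The posterior given $\mathbf y$ is called proper if the integral of likelihood times prior over all of $(\mathbf u,\boldsymbol\beta,\sigma_0,\dots,\sigma_r,\gamma_1,\dots,\gamma_r)$ is positive and finite. Put $t=\operatorname{rank}\{(\mathbf I-\mathbf X(\mathbf X^\top\mathbf X)^{-1}\mathbf X^\top)\mathbf Z\}$, $h(\gamma)=\min\{a(\gamma),b(\gamma)\}$, $H(\gamma)=a(\gamma)+b(\gamma)$,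 and suppose that there are constants $m,M>0$ with $h(\gamma)<m$ and $H(\gamma)>M$ for all $\gamma\in\Gamma$. Consider the conditions - (a) for each $i=1,\dots,r$, either $a_i<b_i=0$ or $b_i>0$; - (b1) $q_i+2a_i>0$ for all $i=1,\dots,r$; - (b2) $q_i+2a_i>q-t$ for all $i=1,\dots,r$; - (c1) $n-p+2\sum_{i=0}^r a_i>0$; - (c2) $n-p+2a_0+2\sum_{i=1}^r\min(0,a_i)>0$; - (d) $\prod_{i=1}^r\int_\Gamma h(\gamma)^{q_i+2a_i}H(\gamma)^{-q_i}\pi_i(\gamma)\,d\gamma<\infty$; - (e) $\prod_{i=1}^r\int_\Gamma H(\gamma)^{2a_i}\pi_i(\gamma)\,d\gamma<\infty$. Let $\mathrm{SSE}(\mathbf y)=\min_{\boldsymbol\beta,\mathbf u}\|\mathbf y-\mathbf X\boldsymbol\beta-\mathbf Z\mathbf u\|^2$. 1. Suppose that $t=q$ or $r=1$. If the posterior given some $\mathbf y\in\mathbb R^n$ is proper, then (a), (b2), (c1) and (d) hold. Conversely, if (a), (b2), (c2) and (e) hold, then the posterior given $\mathbf y$ is proper for every $\mathbf y\in\mathbb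 R^n$ with $2b_0+\mathrm{SSE}(\mathbf y)>0$. 2. Suppose that $t<q$ and $r>1$. If the posterior given some $\mathbf y\in\mathbb R^n$ is proper, then (a), (b1), (c1) and (d) hold. Conversely, if (a), (b2), (c2) and (e) hold, then the posterior given $\mathbf y$ is proper for every $\mathbf y\in\mathbb R^n$ with $2b_0+\mathrm{SSE}(\mathbf y)>0$. Moreover, if $b_0>0$, or if $b_0=0$ and $\operatorname{rank}(\mathbf X:\mathbf Z)<n$, then $2b_0+\mathrm{SSE}(\mathbf y)>0$ for Lebesgue-almost every $\mathbf y\in\mathbb R^n$ (so the sufficient conditions give a proper posterior for almost every sample). -/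

import Mathlib

open MeasureTheory ProbabilityTheory Set
open scoped ENNReal Matrix

noncomputable section

/-- Density at `u` of the two-piece normal distribution `TPN(μ, σ, γ)` with scale functions
`fa, fb` (written `a(·), b(·)` in the mathematics). -/
def tpnDensity (fa fb : ℝ → ℝ) (μ σ γ u : ℝ) : ℝ :=
  2 / (σ * (fa γ + fb γ)) *
    (if u < μ then gaussianPDFReal 0 1 ((u - μ) / (σ * fb γ))
      else gaussianPDFReal 0 1 ((u - μ) / (σ * fa γ)))

/-- The index type of the stacked random effects `u = (u₁, …, u_r)`, where `u_i` has `q i`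
components; the pair `⟨i, k⟩` is the index of `u_{ik}`. -/
abbrev REIndex {r : ℕ} (q : Fin r → ℕ) : Type := Σ i : Fin r, Fin (q i)

/-- Density of `y ∣ u, β, σ₀ ∼ N_n(X β + Z u, σ₀² I_n)`. -/
def normalLikelihood {n p r : ℕ} {q : Fin r → ℕ}
    (X : Matrix (Fin n) (Fin p) ℝ) (Z : Matrix (Fin n) (REIndex q) ℝ)
    (u : REIndex q → ℝ) (β : Fin p → ℝ) (σ₀ : ℝ) (y : Fin n → ℝ) : ℝ :=
  ∏ j, gaussianPDFReal ((X *ᵥ β + Z *ᵥ u) j) (σ₀ ^ 2).toNNReal (y j)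

/-- Density of the random effects: independent `u_{ik} ∣ σ_i, γ_i ∼ TPN(0, σ_i, γ_i)`. -/
def randomEffectsDensity {r : ℕ} {q : Fin r → ℕ} (fa fb : ℝ → ℝ)
    (σ γ : Fin r → ℝ) (u : REIndex q → ℝ) : ℝ :=
  ∏ i, ∏ k : Fin (q i), tpnDensity fa fb 0 (σ i) (γ i) (u ⟨i, k⟩)

/-- The (possibly improper) prior kernel `σ^{-(2a+1)} exp(-b/σ²)` of a scale parameter. -/
def scalePrior (a b σ : ℝ) : ℝ := σ ^ (-(2 * a + 1)) * Real.exp (-b / σ ^ 2)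

/-- The marginal density `m(y)` of the data, up to the constant of the prior: the integral of
likelihood times prior over `γ ∈ Γ^r` (under the product of the priors of the `γ_i`),
`σ ∈ (0,∞)^r`, `σ₀ ∈ (0,∞)`, `β ∈ ℝ^p` (flat prior) and `u ∈ ℝ^q`. -/
def marginalLikelihood {n p r : ℕ} {q : Fin r → ℕ}
    (X : Matrix (Fin n) (Fin p) ℝ) (Z : Matrix (Fin n) (REIndex q) ℝ)
    (Γ : Set ℝ) (fa fb : ℝ → ℝ) (prior : Fin r → Measure ℝ)
    (a₀ b₀ : ℝ) (a b : Fin r → ℝ) (y : Fin n → ℝ) : ℝ≥0∞ :=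
  ∫⁻ γ in Set.univ.pi (fun _ : Fin r => Γ),
    (∫⁻ σ in Set.univ.pi (fun _ : Fin r => Ioi (0 : ℝ)), ∫⁻ σ₀ in Ioi (0 : ℝ),
      ∫⁻ β : Fin p → ℝ, ∫⁻ u : REIndex q → ℝ,
        ENNReal.ofReal (normalLikelihood X Z u β σ₀ y * randomEffectsDensity fa fb σ γ u *
          (scalePrior a₀ b₀ σ₀ * ∏ i, scalePrior (a i) (b i) (σ i))))
    ∂(Measure.pi prior)

/-- The posterior given the sample `y` is proper: its normalising constant is positive and
finite. -/
def ProperPosterior {n p r : ℕ} {q : Fin r → ℕ}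
    (X : Matrix (Fin n) (Fin p) ℝ) (Z : Matrix (Fin n) (REIndex q) ℝ)
    (Γ : Set ℝ) (fa fb : ℝ → ℝ) (prior : Fin r → Measure ℝ)
    (a₀ b₀ : ℝ) (a b : Fin r → ℝ) (y : Fin n → ℝ) : Prop :=
  0 < marginalLikelihood X Z Γ fa fb prior a₀ b₀ a b y ∧
    marginalLikelihood X Z Γ fa fb prior a₀ b₀ a b y < ∞

/-- Sum of squared errors: the least value of `‖y - X β - Z u‖²` over `β` and `u`. -/
def SSE {n p r : ℕ} {q : Fin r → ℕ}
    (X : Matrix (Fin n) (Fin p) ℝ) (Z : Matrix (Fin n) (REIndex q) ℝ) (y : Fin n → ℝ) : ℝ :=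
  ⨅ θ : (Fin p → ℝ) × (REIndex q → ℝ), ∑ j, (y j - (X *ᵥ θ.1 + Z *ᵥ θ.2) j) ^ 2

/-- `t = rank((I - X (Xᵀ X)⁻¹ Xᵀ) Z)`. -/
def residualRank {n p r : ℕ} {q : Fin r → ℕ}
    (X : Matrix (Fin n) (Fin p) ℝ) (Z : Matrix (Fin n) (REIndex q) ℝ) : ℕ :=
  ((1 - X * (Xᵀ * X)⁻¹ * Xᵀ) * Z).rank

/-- Condition (a). -/
def CondA {r : ℕ} (a b : Fin r → ℝ) : Prop :=
  ∀ i, (a i < b i ∧ b i = 0) ∨ 0 < b i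

/-- Condition (b1). -/
def CondB1 {r : ℕ} (q : Fin r → ℕ) (a : Fin r → ℝ) : Prop :=
  ∀ i, 0 < (q i : ℝ) + 2 * a i

/-- Condition (b2), where `t` is the residual rank and `q = ∑ q_i`. -/
def CondB2 {r : ℕ} (q : Fin r → ℕ) (t : ℕ) (a : Fin r → ℝ) : Prop :=
  ∀ i, ((∑ l, q l : ℕ) : ℝ) - (t : ℝ) < (q i : ℝ) + 2 * a i

/-- Condition (c1). -/
def CondC1 (n p : ℕ) {r : ℕ} (a₀ : ℝ) (a : Fin r → ℝ) : Prop :=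
  0 < (n : ℝ) - (p : ℝ) + 2 * (a₀ + ∑ i, a i)

/-- Condition (c2). -/
def CondC2 (n p : ℕ) {r : ℕ} (a₀ : ℝ) (a : Fin r → ℝ) : Prop :=
  0 < (n : ℝ) - (p : ℝ) + 2 * a₀ + 2 * ∑ i, min 0 (a i)

/-- Condition (d). -/
def CondD {r : ℕ} (q : Fin r → ℕ) (Γ : Set ℝ) (fa fb : ℝ → ℝ) (prior : Fin r → Measure ℝ)
    (a : Fin r → ℝ) : Prop :=
  (∏ i, (∫⁻ γ in Γ,
    ENNReal.ofReal ((min (fa γ) (fb γ)) ^ ((q i : ℝ) + 2 * a i) / (fa γ + fb γ) ^ (q i))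
      ∂(prior i))) < ∞

/-- Condition (e). -/
def CondE {r : ℕ} (Γ : Set ℝ) (fa fb : ℝ → ℝ) (prior : Fin r → Measure ℝ)
    (a : Fin r → ℝ) : Prop :=
  (∏ i, (∫⁻ γ in Γ, ENNReal.ofReal ((fa γ + fb γ) ^ (2 * a i)) ∂(prior i))) < ∞

end

/-! The posterior normalising constant is bracketed between integrals that factor over σ₀, the σ_i
and the γ_i, so that propriety is read off from one-dimensional integrals near 0 and near ∞. Write h
= min(a, b) and H = a + b. For |u| ≤ σh the two-piece density is at least a constant times 1/(σH),
and everywhere it is at most twice the N(0, (σH)²) density (`tpnDensity_ge`, `tpnDensity_le`).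

Sufficiency. Choose t columns of Z that complete those of X to a basis of the column space of (X :
Z), and let block i contain m_i of them; then m_i ≥ q_i - (q - t). The regression on these columns
is injective, so a fraction 1 - θ of the residual sum of squares dominates a nondegenerate quadratic
in β and the chosen u's, while the fraction θ is kept as θ·SSE. Gaussian integration then yields
σ₀^(p-n) exp(-θ SSE/(2σ₀²)) ∏ min(1, Cσ₀/τ_i)^(m_i) with τ_i = σ_i H_i
(`exists_lintegral_normal_likelihood_le`). Each minimum is at most a multiple of (1 + σ₀)^κ_i min(1,
1/τ_i)^κ_i for any 0 ≤ κ_i ≤ m_i, which separates the variables. Convergence at ∞ needs κ_i + 2a_i >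
0 and ∑ κ_i < n - p + 2a₀; (b2) and (c2) allow such a choice. Convergence at 0 comes from (a) and
from 2b₀ + SSE > 0. Passing from σ_i to τ_i leaves the factor H_i^(2a_i), which (e) integrates
(`exists_inner_marginal_le`).

Necessity. Restrict u to a set on which the two-piece densities are bounded below, and β to a ball
on which the residual is controlled (`exists_lintegral_likelihood_ge`). A box |u_ik| ≤ min(1, σ_i
h_i) gives a product over the blocks: its factors force (a) at σ_i → 0 and (b1) at σ_i → ∞, and
rescaling them by h gives (d). Letting all scales grow at the rate of σ₀ forces (c1). When r = 1,
the q - t redundant random effects may grow like σ while the chosen ones and β compensate, which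
strengthens (b1) to (b2). When t = q the two conditions coincide. -/

/-! ### Tonelli for products of one-variable functions. -/

/-- Tonelli theorem for a product of functions of single coordinates on `Fin n`. -/
theorem lintegral_fin_prod {n : ℕ} {E : Fin n → Type*}
    {mE : ∀ i, MeasurableSpace (E i)} {μ : (i : Fin n) → Measure (E i)} [∀ i, SigmaFinite (μ i)]
    {f : (i : Fin n) → E i → ℝ≥0∞} (hf : ∀ i, AEMeasurable (f i) (μ i)) :
    ∫⁻ x : (i : Fin n) → E i, ∏ i, f i (x i) ∂(Measure.pi μ) = ∏ i, ∫⁻ x, f i x ∂(μ i) := by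
  induction n with
  | zero => simp
  | succ n ih =>
    calc
      _ = ∫⁻ x : E 0 × ((i : Fin n) → E (Fin.succ i)),
          f 0 x.1 * ∏ i : Fin n, f (Fin.succ i) (x.2 i)
          ∂((μ 0).prod (Measure.pi (fun i => μ i.succ))) := by
        have h := (measurePreserving_piFinSuccAbove μ 0).lintegral_comp_emb
          (MeasurableEquiv.measurableEmbedding _)
          (fun z => f 0 z.1 * ∏ i : Fin n, f (Fin.succ i) (z.2 i))
        simp_rw [Fin.prod_univ_succ]
        exact h
      _ = (∫⁻ x, f 0 x ∂μ 0)
          * ∏ i : Fin n, ∫⁻ (x : E (Fin.succ i)), f (Fin.succ i) x ∂(μ i.succ) := by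
        rw [← ih fun i => hf _, ← lintegral_prod_mul (hf 0)]
        exact Finset.aemeasurable_fun_prod _ fun i _ =>
          (hf i.succ).comp_quasiMeasurePreserving (Measure.quasiMeasurePreserving_eval _ i)
      _ = ∏ i, ∫⁻ x, f i x ∂(μ i) := by rw [Fin.prod_univ_succ]

/-- Tonelli theorem for a product of functions of single coordinates. -/
theorem lintegral_pi_prod {ι : Type*} [Fintype ι] {E : ι → Type*}
    {mE : ∀ i, MeasurableSpace (E i)} {μ : (i : ι) → Measure (E i)} [∀ i, SigmaFinite (μ i)]
    {f : (i : ι) → E i → ℝ≥0∞} (hf : ∀ i, AEMeasurable (f i) (μ i)) :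
    ∫⁻ x : (i : ι) → E i, ∏ i, f i (x i) ∂(Measure.pi μ) = ∏ i, ∫⁻ x, f i x ∂(μ i) := by
  let e := (Fintype.equivFin ι).symm
  rw [← (measurePreserving_piCongrLeft _ e).lintegral_comp_emb
    (MeasurableEquiv.measurableEmbedding _)]
  simp_rw [← e.prod_comp, MeasurableEquiv.coe_piCongrLeft, Equiv.piCongrLeft_apply_apply]
  exact lintegral_fin_prod fun i => hf _

theorem setLIntegral_pi_prod {ι : Type*} [Fintype ι] {E : ι → Type*}
    {mE : ∀ i, MeasurableSpace (E i)} {μ : (i : ι) → Measure (E i)} [∀ i, SigmaFinite (μ i)]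
    (s : ∀ i, Set (E i))
    {f : (i : ι) → E i → ℝ≥0∞} (hf : ∀ i, AEMeasurable (f i) ((μ i).restrict (s i))) :
    ∫⁻ x in univ.pi s, ∏ i, f i (x i) ∂(Measure.pi μ) = ∏ i, ∫⁻ x in s i, f i x ∂(μ i) := by
  rw [Measure.restrict_pi_pi]
  exact lintegral_pi_prod hf

/-! ### Power integrals on the half-line and the scale prior near zero. -/

theorem lintegral_Ioi_rpow_lt_top_iff {s t : ℝ} (ht : 0 < t) :
    ∫⁻ x in Ioi t, ENNReal.ofReal (x ^ s) < ∞ ↔ s < -1 := by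
  rw [← integrableOn_Ioi_rpow_iff ht, IntegrableOn, Integrable,
    hasFiniteIntegral_iff_ofReal]
  · refine ⟨fun h => ⟨?_, h⟩, fun h => h.2⟩
    exact (measurable_id.pow_const s).aestronglyMeasurable
  · exact (ae_restrict_iff' measurableSet_Ioi).2
      (.of_forall fun x hx => Real.rpow_nonneg (ht.trans hx).le _)

theorem lintegral_Ioo_rpow_lt_top_iff {s t : ℝ} (ht : 0 < t) :
    ∫⁻ x in Ioo 0 t, ENNReal.ofReal (x ^ s) < ∞ ↔ -1 < s := by
  rw [← intervalIntegral.integrableOn_Ioo_rpow_iff ht, IntegrableOn, Integrable,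
    hasFiniteIntegral_iff_ofReal]
  · refine ⟨fun h => ⟨?_, h⟩, fun h => h.2⟩
    exact (measurable_id.pow_const s).aestronglyMeasurable
  · exact (ae_restrict_iff' measurableSet_Ioo).2
      (.of_forall fun x hx => Real.rpow_nonneg hx.1.le _)

/-- Change of scale on the half-line. -/
theorem lintegral_Ioi_comp_mul_right {c : ℝ} (hc : 0 < c) (g : ℝ → ℝ≥0∞) :
    ENNReal.ofReal c * ∫⁻ x in Ioi (0 : ℝ), g (x * c) = ∫⁻ x in Ioi (0 : ℝ), g x := by
  have h := lintegral_image_eq_lintegral_abs_deriv_mul (s := Ioi (0 : ℝ)) (f := fun x => x * c)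
    (f' := fun _ => c) measurableSet_Ioi
    (fun x _ => by simpa using ((hasDerivAt_id x).mul_const c).hasDerivWithinAt)
    (fun x _ y _ h => mul_right_cancel₀ hc.ne' h) g
  have himg : (fun x : ℝ => x * c) '' Ioi 0 = Ioi 0 := by
    ext y
    refine ⟨?_, fun hy => ⟨y / c, div_pos hy hc, div_mul_cancel₀ _ hc.ne'⟩⟩
    rintro ⟨x, hx, rfl⟩
    exact mul_pos hx hc
  rw [himg, abs_of_pos hc, lintegral_const_mul' _ _ ENNReal.ofReal_ne_top] at h
  exact h.symm

/-- One term of the exponential series bounds exp(s/σ²) from below; inverting it shows that the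
kernel vanishes at zero faster than any power. -/
theorem exp_neg_div_sq_le {s σ : ℝ} (hs : 0 < s) (hσ : 0 < σ) (N : ℕ) :
    Real.exp (-s / σ ^ 2) ≤ N.factorial / s ^ N * σ ^ (2 * N) := by
  have h := Real.pow_div_factorial_le_exp (s / σ ^ 2) (by positivity) N
  rw [neg_div, Real.exp_neg]
  have h1 : 0 < (s / σ ^ 2) ^ N / N.factorial := by positivity
  refine (inv_anti₀ h1 h).trans_eq ?_
  rw [div_pow, inv_div, pow_mul]
  field_simp

/-- The kernel `σ ^ x * exp (-s / σ ^ 2)` is integrable near zero. -/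
theorem lintegral_Ioc_rpow_mul_exp_lt_top {s : ℝ} (hs : 0 < s) (x : ℝ) :
    ∫⁻ σ in Ioc (0 : ℝ) 1, ENNReal.ofReal (σ ^ x * Real.exp (-s / σ ^ 2)) < ∞ := by
  -- This N makes the exponent x + 2N nonnegative, so the integrand is bounded on (0, 1].
  obtain ⟨N, hN⟩ := exists_nat_ge (-x)
  have hbd : ∀ σ ∈ Ioc (0 : ℝ) 1, ENNReal.ofReal (σ ^ x * Real.exp (-s / σ ^ 2)) ≤
      ENNReal.ofReal (N.factorial / s ^ N) := by
    intro σ hσ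
    refine ENNReal.ofReal_le_ofReal ?_
    calc σ ^ x * Real.exp (-s / σ ^ 2)
        ≤ σ ^ x * (N.factorial / s ^ N * σ ^ (2 * N)) := by
          gcongr
          · exact Real.rpow_nonneg hσ.1.le _
          · exact exp_neg_div_sq_le hs hσ.1 N
      _ = N.factorial / s ^ N * σ ^ (x + (2 * N : ℕ)) := by
          rw [Real.rpow_add hσ.1, Real.rpow_natCast]; ring
      _ ≤ N.factorial / s ^ N * 1 := by
          gcongr
          refine Real.rpow_le_one hσ.1.le hσ.2 ?_
          push_cast
          have : (0 : ℝ) ≤ N := N.cast_nonneg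
          linarith
      _ = _ := mul_one _
  refine (setLIntegral_mono' measurableSet_Ioc hbd).trans_lt ?_
  rw [setLIntegral_const]
  exact ENNReal.mul_lt_top ENNReal.ofReal_lt_top (by simp)

theorem scalePrior_pos {a b σ : ℝ} (hσ : 0 < σ) : 0 < scalePrior a b σ :=
  mul_pos (Real.rpow_pos_of_pos hσ _) (Real.exp_pos _)

theorem measurable_scalePrior (a b : ℝ) : Measurable (scalePrior a b) := by
  unfold scalePrior
  fun_prop

/-- If the scale prior is integrable near zero, then `a < b = 0` or `b > 0`. -/
theorem cond_of_lintegral_scalePrior_lt_top {a b s : ℝ} (hs : 0 < s)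
    (h : ∫⁻ σ in Ioo (0 : ℝ) s, ENNReal.ofReal (scalePrior a b σ) < ∞) :
    (a < b ∧ b = 0) ∨ 0 < b := by
  by_contra hcon
  push Not at hcon
  obtain ⟨hc, hb⟩ := hcon
  -- When the condition fails, the prior dominates a nonintegrable power: for b = 0 it is that
  -- power, since a ≥ 0; for b < 0 the N-th series term of the growing exponential supplies σ^(-2N).
  have key : ∃ c : ℝ, 0 < c ∧ ∃ x : ℝ, x ≤ -1 ∧
      ∀ σ : ℝ, 0 < σ → c * σ ^ x ≤ scalePrior a b σ := by
    rcases hb.eq_or_lt with rfl | hb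
    · have ha : 0 ≤ a := by
        by_contra ha
        exact hc (not_le.1 ha) rfl
      exact ⟨1, one_pos, -(2 * a + 1), by linarith, fun σ _ => by simp [scalePrior]⟩
    · obtain ⟨N, hN⟩ := exists_nat_ge (-a)
      refine ⟨(-b) ^ N / N.factorial, by have := neg_pos.2 hb; positivity,
        -(2 * a + 1) - (2 * N : ℕ), by push_cast; linarith, fun σ hσ => ?_⟩
      have h1 := Real.pow_div_factorial_le_exp (-b / σ ^ 2)
        (div_nonneg (neg_nonneg.2 hb.le) (by positivity)) N
      rw [Real.rpow_sub hσ, Real.rpow_natCast, scalePrior]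
      calc (-b) ^ N / N.factorial * (σ ^ (-(2 * a + 1)) / σ ^ (2 * N))
          = σ ^ (-(2 * a + 1)) * ((-b / σ ^ 2) ^ N / N.factorial) := by
            rw [div_pow, ← pow_mul]; field_simp
        _ ≤ _ := by gcongr
  obtain ⟨c, hc0, x, hx, hle⟩ := key
  have h2 : ENNReal.ofReal c * ∫⁻ σ in Ioo (0 : ℝ) s, ENNReal.ofReal (σ ^ x) < ∞ := by
    rw [← lintegral_const_mul' _ _ ENNReal.ofReal_ne_top]
    refine lt_of_le_of_lt (setLIntegral_mono' measurableSet_Ioo fun σ hσ => ?_) h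
    rw [← ENNReal.ofReal_mul hc0.le]
    exact ENNReal.ofReal_le_ofReal (hle σ hσ.1)
  have h3 := ENNReal.lt_top_of_mul_ne_top_right h2.ne (by simpa using hc0)
  rw [lintegral_Ioo_rpow_lt_top_iff hs] at h3
  linarith

/-! ### Linear algebra: complementary columns and injective regressions. -/

/-- A matrix of full column rank has an invertible Gram matrix. -/
theorem isUnit_det_gram {n p : ℕ} {X : Matrix (Fin n) (Fin p) ℝ} (hX : X.rank = p) :
    IsUnit (Xᵀ * X).det := by
  rw [← Matrix.isUnit_iff_isUnit_det, ← Matrix.linearIndependent_cols_iff_isUnit,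
    ← Matrix.mulVec_injective_iff]
  have h := Matrix.rank_transpose_mul_self X
  rw [hX, Matrix.rank] at h
  have h2 := LinearMap.finrank_range_add_finrank_ker (Xᵀ * X).mulVecLin
  rw [h, Module.finrank_fin_fun] at h2
  have h3 : LinearMap.ker (Xᵀ * X).mulVecLin = ⊥ := Submodule.finrank_eq_zero.1 (by omega)
  exact LinearMap.ker_eq_bot.1 h3

/-- The regression map on `X` and the columns of `Z` indexed by `B`. -/
def columnMap {n p : ℕ} {ι : Type*} [Fintype ι] (X : Matrix (Fin n) (Fin p) ℝ)
    (Z : Matrix (Fin n) ι ℝ) (B : ι → Prop) [DecidablePred B] :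
    ((Fin p → ℝ) × ({k // B k} → ℝ)) →ₗ[ℝ] (Fin n → ℝ) :=
  X.mulVecLin.coprod (Z.submatrix id Subtype.val).mulVecLin

theorem columnMap_apply {n p : ℕ} {ι : Type*} [Fintype ι] (X : Matrix (Fin n) (Fin p) ℝ)
    (Z : Matrix (Fin n) ι ℝ) (B : ι → Prop) [DecidablePred B] (β : Fin p → ℝ) (v : {k // B k} → ℝ) :
    columnMap X Z B (β, v) = X *ᵥ β + Z.submatrix id Subtype.val *ᵥ v := rfl

/-- Columns of `Z` completing those of `X` to a basis of the column space of `(X : Z)`. -/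
theorem exists_complementary_columns {n p : ℕ} {ι : Type*} [Fintype ι]
    {X : Matrix (Fin n) (Fin p) ℝ} (Z : Matrix (Fin n) ι ℝ) (hX : X.rank = p) :
    ∃ (B : ι → Prop) (_ : DecidablePred B), Fintype.card {k // B k} =
      ((1 - X * (Xᵀ * X)⁻¹ * Xᵀ) * Z).rank ∧
      Function.Injective (columnMap X Z B) ∧
      ∀ k, Z.col k ∈ LinearMap.range (columnMap X Z B) := by
  classical
  have hu := isUnit_det_gram hX
  set P : Matrix (Fin n) (Fin n) ℝ := 1 - X * (Xᵀ * X)⁻¹ * Xᵀ with hP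
  have hPX : P * X = 0 := by
    rw [hP, Matrix.sub_mul, Matrix.one_mul, Matrix.mul_assoc, Matrix.mul_assoc,
      Matrix.nonsing_inv_mul _ hu,
      Matrix.mul_one, sub_self]
  have hXinj : Function.Injective X.mulVec := by
    intro v w hvw
    have h : (Xᵀ * X)⁻¹ *ᵥ (Xᵀ *ᵥ (X *ᵥ v)) = (Xᵀ * X)⁻¹ *ᵥ (Xᵀ *ᵥ (X *ᵥ w)) := by
      rw [show X *ᵥ v = X *ᵥ w from hvw]
    simpa [Matrix.mulVec_mulVec, Matrix.mul_assoc, Matrix.nonsing_inv_mul _ hu] using h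
  -- The index set is a maximal independent family among the columns of PZ, P being the projection
  -- that kills X. Its size is rank(PZ), and independence modulo the range of X gives injectivity.
  obtain ⟨S, -, -, hspan, hli⟩ := exists_linearIndepOn_extension
    (K := ℝ) (v := (P * Z).col) (linearIndepOn_empty ℝ (P * Z).col) (subset_univ ∅)
  have hcol : ∀ k, (P * Z).col k = P *ᵥ Z.col k := fun k => rfl
  have hsub : ∀ v : {k // k ∈ S} → ℝ,
      P *ᵥ (Z.submatrix id Subtype.val *ᵥ v) = ∑ b, v b • (P * Z).col b := by
    intro v
    rw [Matrix.mulVec_mulVec, Matrix.mulVec_eq_sum]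
    refine Finset.sum_congr rfl fun b _ => ?_
    ext j
    simp [Matrix.mul_apply, Matrix.col, mul_comm]
  refine ⟨fun k => k ∈ S, Classical.decPred _, ?_, ?_, ?_⟩
  · rw [Matrix.rank_eq_finrank_span_cols]
    have h1 : Submodule.span ℝ (range (P * Z).col) =
        Submodule.span ℝ (range fun b : {k // k ∈ S} => (P * Z).col b) := by
      apply le_antisymm
      · rw [Submodule.span_le, ← image_univ]
        refine hspan.trans ?_
        rw [image_eq_range]
      · exact Submodule.span_mono (by rintro _ ⟨b, rfl⟩; exact ⟨b, rfl⟩)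
    rw [h1, finrank_span_eq_card hli]
  · rw [← LinearMap.ker_eq_bot, LinearMap.ker_eq_bot']
    rintro ⟨β, v⟩ h
    rw [columnMap_apply] at h
    have h1 := congrArg (P *ᵥ ·) h
    simp only [Matrix.mulVec_add, Matrix.mulVec_mulVec, hPX, Matrix.zero_mulVec, zero_add,
      Matrix.mulVec_zero] at h1
    rw [← Matrix.mulVec_mulVec, hsub] at h1
    have hv : v = 0 := funext (Fintype.linearIndependent_iff.1 hli v h1)
    subst hv
    rw [Matrix.mulVec_zero, add_zero] at h
    have : β = 0 := hXinj (by simpa using h)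
    rw [this]; rfl
  · intro k
    have h1 : (P * Z).col k ∈ Submodule.span ℝ
        (range fun b : {k // k ∈ S} => (P * Z).col b) := by
      have := hspan (mem_image_of_mem _ (mem_univ k))
      rwa [image_eq_range] at this
    obtain ⟨v, hv⟩ := (Submodule.mem_span_range_iff_exists_fun ℝ).1 h1
    rw [← hsub, hcol] at hv
    -- The difference is killed by P, hence equals its own projection on the range of X; the
    -- least-squares coefficients are therefore exact.
    refine ⟨((Xᵀ * X)⁻¹ *ᵥ (Xᵀ *ᵥ (Z.col k - Z.submatrix id Subtype.val *ᵥ v)), v), ?_⟩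
    have h2 : P *ᵥ (Z.col k - Z.submatrix id Subtype.val *ᵥ v) = 0 := by
      rw [Matrix.mulVec_sub, hv, sub_self]
    rw [hP, Matrix.sub_mulVec, Matrix.one_mulVec, ← Matrix.mulVec_mulVec,
      ← Matrix.mulVec_mulVec, sub_eq_zero] at h2
    rw [columnMap_apply, ← h2, sub_add_cancel]

/-- A linear map on a finite-dimensional real normed space is bounded. -/
theorem LinearMap.exists_norm_le {E F : Type*} [NormedAddCommGroup E] [NormedSpace ℝ E]
    [FiniteDimensional ℝ E] [NormedAddCommGroup F] [NormedSpace ℝ F] (f : E →ₗ[ℝ] F) :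
    ∃ C : ℝ, 0 < C ∧ ∀ x, ‖f x‖ ≤ C * ‖x‖ := by
  refine ⟨‖f.toContinuousLinearMap‖ + 1, by positivity, fun x => ?_⟩
  have := f.toContinuousLinearMap.le_opNorm x
  refine this.trans ?_
  gcongr
  linarith

theorem sq_norm_le_sum_sq {ι : Type*} [Fintype ι] (x : ι → ℝ) : ‖x‖ ^ 2 ≤ ∑ j, x j ^ 2 := by
  have h : ‖x‖ ≤ √(∑ j, x j ^ 2) := by
    refine (pi_norm_le_iff_of_nonneg (Real.sqrt_nonneg _)).2 fun j => ?_
    rw [Real.norm_eq_abs]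
    exact Real.abs_le_sqrt (Finset.single_le_sum (f := fun j => x j ^ 2)
      (fun _ _ => sq_nonneg _) (Finset.mem_univ j))
  calc ‖x‖ ^ 2 ≤ √(∑ j, x j ^ 2) ^ 2 := by gcongr
    _ = _ := Real.sq_sqrt (Finset.sum_nonneg fun _ _ => sq_nonneg _)

theorem sum_sq_le_card_mul_sq_norm {ι : Type*} [Fintype ι] (x : ι → ℝ) :
    ∑ j, x j ^ 2 ≤ Fintype.card ι * ‖x‖ ^ 2 := by
  calc ∑ j, x j ^ 2 ≤ ∑ _j : ι, ‖x‖ ^ 2 := by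
        refine Finset.sum_le_sum fun j _ => ?_
        rw [← sq_abs, ← Real.norm_eq_abs]
        gcongr
        exact norm_le_pi_norm x j
    _ = _ := by simp

/-- An injective regression has residuals growing quadratically away from some point. -/
theorem exists_sum_sq_residual_ge {n p : ℕ} {κ : Type*} [Fintype κ]
    {W : ((Fin p → ℝ) × (κ → ℝ)) →ₗ[ℝ] (Fin n → ℝ)} (hW : Function.Injective W) :
    ∃ c : ℝ, 0 < c ∧ ∀ w : Fin n → ℝ, ∃ (β' : Fin p → ℝ) (v' : κ → ℝ), ∀ β v,
      c * (∑ j, (β j - β' j) ^ 2 + ∑ k, (v k - v' k) ^ 2) ≤ ∑ j, (w j - W (β, v) j) ^ 2 := by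
  obtain ⟨L, hL⟩ := W.exists_leftInverse_of_injective (LinearMap.ker_eq_bot.2 hW)
  obtain ⟨C, hC, hLC⟩ := L.exists_norm_le
  -- The centre is L w for a left inverse L, and L maps the residual to the deviation from this
  -- centre. Norms are sup norms, so passing to sums of squares costs the number of coordinates; the
  -- `+ 1` keeps N positive when there are none.
  set N : ℝ := (p + Fintype.card κ) * C ^ 2 + 1 with hN
  have hN0 : 0 < N := by positivity
  refine ⟨N⁻¹, by positivity, fun w => ⟨(L w).1, (L w).2, fun β v => ?_⟩⟩
  set x : Fin n → ℝ := w - W (β, v) with hx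
  have hLx : L x = ((L w).1 - β, (L w).2 - v) := by
    rw [hx, map_sub, show L (W (β, v)) = (β, v) from LinearMap.congr_fun hL (β, v)]
    rfl
  have h1 : ‖(L w).1 - β‖ ≤ C * ‖x‖ := by
    refine le_trans ?_ (hLC x); rw [hLx]; exact norm_fst_le ((L w).1 - β, (L w).2 - v)
  have h2 : ‖(L w).2 - v‖ ≤ C * ‖x‖ := by
    refine le_trans ?_ (hLC x); rw [hLx]; exact norm_snd_le ((L w).1 - β, (L w).2 - v)
  have h3 := sum_sq_le_card_mul_sq_norm ((L w).1 - β)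
  have h4 := sum_sq_le_card_mul_sq_norm ((L w).2 - v)
  have h5 := sq_norm_le_sum_sq x
  have e1 : ∑ j, (β j - (L w).1 j) ^ 2 = ∑ j, ((L w).1 - β) j ^ 2 :=
    Finset.sum_congr rfl fun j _ => by rw [Pi.sub_apply]; ring
  have e2 : ∑ k, (v k - (L w).2 k) ^ 2 = ∑ k, ((L w).2 - v) k ^ 2 :=
    Finset.sum_congr rfl fun j _ => by rw [Pi.sub_apply]; ring
  rw [e1, e2, inv_mul_le_iff₀ hN0]
  have h6 : ‖(L w).1 - β‖ ^ 2 ≤ (C * ‖x‖) ^ 2 := by gcongr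
  have h7 : ‖(L w).2 - v‖ ^ 2 ≤ (C * ‖x‖) ^ 2 := by gcongr
  rw [Fintype.card_fin] at h3
  calc _ ≤ (p : ℝ) * (C * ‖x‖) ^ 2 + Fintype.card κ * (C * ‖x‖) ^ 2 := by
        gcongr
        · exact h3.trans (by gcongr)
        · exact h4.trans (by gcongr)
    _ ≤ N * ‖x‖ ^ 2 := by rw [hN]; nlinarith [sq_nonneg ‖x‖]
    _ ≤ N * ∑ j, x j ^ 2 := by gcongr

theorem mulVec_eq_add_subtype {n : ℕ} {ι : Type*} [Fintype ι]
    (Z : Matrix (Fin n) ι ℝ) (B : ι → Prop) [DecidablePred B] (u : ι → ℝ) :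
    Z *ᵥ u = Z.submatrix id (Subtype.val : {k // B k} → ι) *ᵥ (fun k => u k) +
      Z.submatrix id (Subtype.val : {k // ¬ B k} → ι) *ᵥ (fun k => u k) := by
  ext j
  simp only [Matrix.mulVec, dotProduct, Pi.add_apply, Matrix.submatrix_apply, id]
  exact (Fintype.sum_subtype_add_sum_subtype B fun k => Z j k * u k).symm

/-- If all columns of `Z` are combinations of those of `X` and of `Z` in `B`, then so is `Z u`,
with coefficients depending linearly on the remaining coordinates of `u`. -/
theorem exists_linear_completion {n p : ℕ} {ι : Type*} [Fintype ι]
    {X : Matrix (Fin n) (Fin p) ℝ} {Z : Matrix (Fin n) ι ℝ} {B : ι → Prop} [DecidablePred B]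
    (hinj : Function.Injective (columnMap X Z B))
    (hZ : ∀ k, Z.col k ∈ LinearMap.range (columnMap X Z B)) :
    ∃ (g : ({k // ¬ B k} → ℝ) →ₗ[ℝ] (Fin p → ℝ))
      (R : ({k // ¬ B k} → ℝ) →ₗ[ℝ] ({k // B k} → ℝ)), ∀ u : ι → ℝ,
      Z *ᵥ u = X *ᵥ g (fun k => u k) + Z.submatrix id (Subtype.val : {k // B k} → ι) *ᵥ
        ((fun k : {k // B k} => u k) + R (fun k => u k)) := by
  obtain ⟨L, hL⟩ := (columnMap X Z B).exists_leftInverse_of_injective (LinearMap.ker_eq_bot.2 hinj)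
  set Zc : Matrix (Fin n) {k // ¬ B k} ℝ := Z.submatrix id Subtype.val
  refine ⟨LinearMap.fst ℝ _ _ ∘ₗ L ∘ₗ Zc.mulVecLin,
    LinearMap.snd ℝ _ _ ∘ₗ L ∘ₗ Zc.mulVecLin, fun u => ?_⟩
  have hmem : Zc *ᵥ (fun k => u k) ∈ LinearMap.range (columnMap X Z B) := by
    rw [Matrix.mulVec_eq_sum]
    exact Submodule.sum_mem _ fun k _ => by
      rw [op_smul_eq_smul]; exact Submodule.smul_mem _ _ (hZ k)
  obtain ⟨θ, hθ⟩ := hmem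
  have hLθ : L (Zc *ᵥ (fun k => u k)) = θ := by
    rw [← hθ]; exact LinearMap.congr_fun hL θ
  rw [mulVec_eq_add_subtype Z B u]
  simp only [LinearMap.comp_apply, Matrix.mulVecLin_apply, hLθ, LinearMap.fst_apply,
    LinearMap.snd_apply, Matrix.mulVec_add]
  rw [← hθ, show columnMap X Z B θ = X *ᵥ θ.1 + Z.submatrix id Subtype.val *ᵥ θ.2 from rfl]
  abel

/-! ### The minimal residual sum of squares. -/

section SSE

variable {n p r : ℕ} {q : Fin r → ℕ} (X : Matrix (Fin n) (Fin p) ℝ)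
  (Z : Matrix (Fin n) (REIndex q) ℝ)

theorem SSE_le (y : Fin n → ℝ) (β : Fin p → ℝ) (u : REIndex q → ℝ) :
    SSE X Z y ≤ ∑ j, (y j - (X *ᵥ β + Z *ᵥ u) j) ^ 2 :=
  ciInf_le (f := fun θ : (Fin p → ℝ) × (REIndex q → ℝ) =>
      ∑ j, (y j - (X *ᵥ θ.1 + Z *ᵥ θ.2) j) ^ 2)
    ⟨0, by rintro _ ⟨θ, rfl⟩; exact Finset.sum_nonneg fun _ _ => sq_nonneg _⟩ (β, u)

theorem SSE_nonneg (y : Fin n → ℝ) : 0 ≤ SSE X Z y :=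
  le_ciInf fun _ => Finset.sum_nonneg fun _ _ => sq_nonneg _

/-- A finite-dimensional subspace is closed, so a point outside it lies at positive distance, and
the sum of squares dominates the squared sup norm. -/
theorem SSE_pos {y : Fin n → ℝ}
    (hy : y ∉ LinearMap.range (Matrix.fromCols X Z).mulVecLin) : 0 < SSE X Z y := by
  have hcl : IsClosed (LinearMap.range (Matrix.fromCols X Z).mulVecLin : Set (Fin n → ℝ)) :=
    Submodule.closed_of_finiteDimensional _
  obtain ⟨δ, hδ, hball⟩ := Metric.isOpen_iff.1 hcl.isOpen_compl y hy
  refine (pow_pos hδ 2).trans_le (le_ciInf fun θ => ?_)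
  set v : Fin n → ℝ := X *ᵥ θ.1 + Z *ᵥ θ.2 with hv
  have hmem : v ∈ (LinearMap.range (Matrix.fromCols X Z).mulVecLin : Set (Fin n → ℝ)) :=
    ⟨Sum.elim θ.1 θ.2, Matrix.fromCols_mulVec_sumElim ..⟩
  have hd : δ ≤ ‖y - v‖ := by
    by_contra hlt
    refine hball (a := v) ?_ hmem
    rw [Metric.mem_ball, dist_eq_norm, norm_sub_rev]
    exact not_le.1 hlt
  calc δ ^ 2 ≤ ‖y - v‖ ^ 2 := by gcongr
    _ ≤ _ := sq_norm_le_sum_sq _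

/-- By the rank deficiency the column space is a proper subspace, hence Lebesgue null. -/
theorem ae_SSE_pos (h : (Matrix.fromCols X Z).rank < n) : ∀ᵐ y : Fin n → ℝ, 0 < SSE X Z y := by
  have htop : LinearMap.range (Matrix.fromCols X Z).mulVecLin ≠ ⊤ := by
    intro ht
    rw [Matrix.rank, ht, finrank_top, Module.finrank_fin_fun] at h
    exact h.false
  have h0 := Measure.addHaar_submodule volume _ htop
  filter_upwards [compl_mem_ae_iff.2 h0] with y hy
  exact SSE_pos X Z hy

end SSE

/-! ### Pointwise bounds for the densities and a lower bound for the integrated likelihood. -/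

section Densities

variable {n p r : ℕ} {q : Fin r → ℕ} (X : Matrix (Fin n) (Fin p) ℝ)
  (Z : Matrix (Fin n) (REIndex q) ℝ)

theorem gaussianPDFReal_sq_toNNReal {s : ℝ} (hs : 0 < s) (μ x : ℝ) :
    gaussianPDFReal μ (s ^ 2).toNNReal x =
      (√(2 * Real.pi) * s)⁻¹ * Real.exp (-(x - μ) ^ 2 / (2 * s ^ 2)) := by
  rw [gaussianPDFReal, Real.coe_toNNReal _ (sq_nonneg s), Real.sqrt_mul (by positivity),
    Real.sqrt_sq hs.le]

theorem gaussianPDFReal_zero_one (x : ℝ) :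
    gaussianPDFReal 0 1 x = (√(2 * Real.pi))⁻¹ * Real.exp (-x ^ 2 / 2) := by
  simp [gaussianPDFReal]

theorem normalLikelihood_eq (u : REIndex q → ℝ) (β : Fin p → ℝ) {σ₀ : ℝ} (hσ₀ : 0 < σ₀)
    (y : Fin n → ℝ) :
    normalLikelihood X Z u β σ₀ y = ((√(2 * Real.pi) * σ₀)⁻¹) ^ n *
      Real.exp (-(∑ j, (y j - (X *ᵥ β + Z *ᵥ u) j) ^ 2) / (2 * σ₀ ^ 2)) := by
  simp_rw [normalLikelihood, gaussianPDFReal_sq_toNNReal hσ₀, Finset.prod_mul_distrib,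
    ← Real.exp_sum, ← Finset.sum_div, Finset.sum_neg_distrib]
  simp

theorem normalLikelihood_nonneg (u : REIndex q → ℝ) (β : Fin p → ℝ) (σ₀ : ℝ) (y : Fin n → ℝ) :
    0 ≤ normalLikelihood X Z u β σ₀ y :=
  Finset.prod_nonneg fun _ _ => gaussianPDFReal_nonneg _ _ _

theorem measurable_normalLikelihood (σ₀ : ℝ) (y : Fin n → ℝ) :
    Measurable fun z : (Fin p → ℝ) × (REIndex q → ℝ) => normalLikelihood X Z z.2 z.1 σ₀ y := by
  have hc : Continuous fun z : (Fin p → ℝ) × (REIndex q → ℝ) => X *ᵥ z.1 + Z *ᵥ z.2 :=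
    (continuous_const.matrix_mulVec continuous_fst).add
      (continuous_const.matrix_mulVec continuous_snd)
  unfold normalLikelihood gaussianPDFReal
  refine Finset.measurable_fun_prod _ fun j _ => ?_
  have := ((continuous_apply j).comp hc).measurable
  simp only [Function.comp_def] at this
  fun_prop

variable {fa fb : ℝ → ℝ}

theorem measurable_tpnDensity (μ σ γ : ℝ) : Measurable (tpnDensity fa fb μ σ γ) := by
  unfold tpnDensity
  refine Measurable.const_mul (Measurable.ite measurableSet_Iio ?_ ?_) _
  · exact (measurable_gaussianPDFReal 0 1).comp (by fun_prop)
  · exact (measurable_gaussianPDFReal 0 1).comp (by fun_prop)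

theorem measurable_randomEffectsDensity (σ γ : Fin r → ℝ) :
    Measurable (randomEffectsDensity (q := q) fa fb σ γ) := by
  unfold randomEffectsDensity
  exact Finset.measurable_fun_prod _ fun i _ => Finset.measurable_fun_prod _ fun k _ =>
    (measurable_tpnDensity 0 (σ i) (γ i)).comp (measurable_pi_apply _)

/-- In this range both pieces evaluate the normal density at arguments of modulus at most 1, where
it is at least its value at 1. -/
theorem tpnDensity_ge {σ γ u : ℝ} (hσ : 0 < σ) (ha : 0 < fa γ) (hb : 0 < fb γ)
    (hu : |u| ≤ σ * min (fa γ) (fb γ)) :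
    2 * gaussianPDFReal 0 1 1 * (σ * (fa γ + fb γ))⁻¹ ≤ tpnDensity fa fb 0 σ γ u := by
  have key : ∀ s : ℝ, 0 < s → min (fa γ) (fb γ) ≤ s →
      gaussianPDFReal 0 1 1 ≤ gaussianPDFReal 0 1 (u / (σ * s)) := by
    intro s hs hms
    have h1 : |u / (σ * s)| ≤ 1 := by
      rw [abs_div, abs_of_pos (mul_pos hσ hs), div_le_one (mul_pos hσ hs)]
      exact hu.trans (by gcongr)
    have h2 : (u / (σ * s)) ^ 2 ≤ 1 ^ 2 := by rwa [sq_le_sq, abs_one]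
    rw [gaussianPDFReal_zero_one, gaussianPDFReal_zero_one]
    gcongr
  rw [tpnDensity, sub_zero, div_eq_mul_inv]
  have h0 : 0 < σ * (fa γ + fb γ) := mul_pos hσ (add_pos ha hb)
  calc _ = 2 * (σ * (fa γ + fb γ))⁻¹ * gaussianPDFReal 0 1 1 := by ring
    _ ≤ _ := by
      gcongr
      split_ifs
      · exact key _ hb (min_le_right _ _)
      · exact key _ ha (min_le_left _ _)

/-- Each piece has scale at most σ(a + b), and widening the scale raises the exponential. The
normalising factor of the two-piece density is already twice that of the normal with scale σ(a + b).
-/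
theorem tpnDensity_le {σ γ : ℝ} (hσ : 0 < σ) (ha : 0 < fa γ) (hb : 0 < fb γ) (u : ℝ) :
    tpnDensity fa fb 0 σ γ u ≤
      2 * gaussianPDFReal 0 ((σ * (fa γ + fb γ)) ^ 2).toNNReal u := by
  have h0 : 0 < σ * (fa γ + fb γ) := mul_pos hσ (add_pos ha hb)
  have key : ∀ s : ℝ, 0 < s → s ≤ fa γ + fb γ → gaussianPDFReal 0 1 (u / (σ * s)) ≤
      (√(2 * Real.pi))⁻¹ * Real.exp (-(u - 0) ^ 2 / (2 * (σ * (fa γ + fb γ)) ^ 2)) := by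
    intro s hs hms
    have e : -(u / (σ * s)) ^ 2 / 2 = -(u ^ 2 / (2 * (σ * s) ^ 2)) := by
      rw [div_pow, neg_div, div_div, mul_comm 2]
    rw [gaussianPDFReal_zero_one, sub_zero, e, neg_div]
    gcongr
  rw [tpnDensity, sub_zero, gaussianPDFReal_sq_toNNReal h0, mul_inv, div_eq_mul_inv]
  calc _ ≤ 2 * (σ * (fa γ + fb γ))⁻¹ * ((√(2 * Real.pi))⁻¹ *
        Real.exp (-(u - 0) ^ 2 / (2 * (σ * (fa γ + fb γ)) ^ 2))) := by
        gcongr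
        split_ifs
        · exact key _ hb (by linarith)
        · exact key _ ha (by linarith)
    _ = _ := by ring

theorem tpnDensity_nonneg {σ γ : ℝ} (hσ : 0 < σ) (ha : 0 < fa γ) (hb : 0 < fb γ) (u : ℝ) :
    0 ≤ tpnDensity fa fb 0 σ γ u := by
  have h0 : 0 < σ * (fa γ + fb γ) := mul_pos hσ (add_pos ha hb)
  unfold tpnDensity
  refine mul_nonneg (by positivity) ?_
  split_ifs <;> exact gaussianPDFReal_nonneg _ _ _

variable {σ γ : Fin r → ℝ}

theorem randomEffectsDensity_ge (hσ : ∀ i, 0 < σ i) (ha : ∀ i, 0 < fa (γ i))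
    (hb : ∀ i, 0 < fb (γ i)) {u : REIndex q → ℝ}
    (hu : ∀ i k, |u ⟨i, k⟩| ≤ σ i * min (fa (γ i)) (fb (γ i))) :
    (2 * gaussianPDFReal 0 1 1) ^ (∑ i, q i) * ∏ i, ((σ i * (fa (γ i) + fb (γ i)))⁻¹) ^ q i ≤
      randomEffectsDensity fa fb σ γ u := by
  rw [← Finset.prod_pow_eq_pow_sum, ← Finset.prod_mul_distrib, randomEffectsDensity]
  have hpos : ∀ i, 0 ≤ 2 * gaussianPDFReal 0 1 1 * (σ i * (fa (γ i) + fb (γ i)))⁻¹ := fun i => by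
    have h0 : 0 < σ i * (fa (γ i) + fb (γ i)) := mul_pos (hσ i) (add_pos (ha i) (hb i))
    have := gaussianPDFReal_nonneg 0 1 1
    positivity
  refine Finset.prod_le_prod (fun i _ => by rw [← mul_pow]; exact pow_nonneg (hpos i) _)
    fun i _ => ?_
  calc _ = ∏ _k : Fin (q i), 2 * gaussianPDFReal 0 1 1 * (σ i * (fa (γ i) + fb (γ i)))⁻¹ := by
        simp [← mul_pow]
    _ ≤ _ := Finset.prod_le_prod (fun _ _ => hpos i)
        fun k _ => tpnDensity_ge (hσ i) (ha i) (hb i) (hu i k)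

theorem randomEffectsDensity_le (hσ : ∀ i, 0 < σ i) (ha : ∀ i, 0 < fa (γ i))
    (hb : ∀ i, 0 < fb (γ i)) (u : REIndex q → ℝ) :
    randomEffectsDensity fa fb σ γ u ≤ 2 ^ (∑ i, q i) *
      ∏ k : REIndex q,
        gaussianPDFReal 0 ((σ k.1 * (fa (γ k.1) + fb (γ k.1))) ^ 2).toNNReal (u k) := by
  rw [← Finset.prod_pow_eq_pow_sum, Fintype.prod_sigma, ← Finset.prod_mul_distrib,
    randomEffectsDensity]
  refine Finset.prod_le_prod (fun i _ => Finset.prod_nonneg fun _ _ =>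
    tpnDensity_nonneg (hσ i) (ha i) (hb i) _) fun i _ => ?_
  calc _ ≤ ∏ k : Fin (q i), 2 * gaussianPDFReal 0
        ((σ i * (fa (γ i) + fb (γ i))) ^ 2).toNNReal (u ⟨i, k⟩) :=
        Finset.prod_le_prod (fun _ _ => tpnDensity_nonneg (hσ i) (ha i) (hb i) _)
          fun k _ => tpnDensity_le (hσ i) (ha i) (hb i) _
    _ = _ := by rw [Finset.prod_mul_distrib]; simp

/-- The lower bound needs u as the outer variable, because the ball of fixed effects is centred at a
point depending on u. -/
theorem lintegral_likelihood_swap (σ₀ w : ℝ) (y : Fin n → ℝ) :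
    (∫⁻ β : Fin p → ℝ, ∫⁻ u : REIndex q → ℝ,
      ENNReal.ofReal (normalLikelihood X Z u β σ₀ y * randomEffectsDensity fa fb σ γ u * w)) =
    ∫⁻ u : REIndex q → ℝ, ∫⁻ β : Fin p → ℝ,
      ENNReal.ofReal (normalLikelihood X Z u β σ₀ y * randomEffectsDensity fa fb σ γ u * w) := by
  refine lintegral_lintegral_swap (Measurable.aemeasurable ?_)
  exact (((measurable_normalLikelihood X Z σ₀ y).mul
    ((measurable_randomEffectsDensity σ γ).comp measurable_snd)).mul_const w).ennreal_ofReal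

/-- Lower bound for the density of the data given the scale parameters: the contribution of
random effects in a set `E` on which the fixed effects can compensate `Z u`. -/
theorem exists_lintegral_likelihood_ge (y : Fin n → ℝ) :
    ∃ c C : ℝ, 0 < c ∧ 0 ≤ C ∧ ∀ (fa fb : ℝ → ℝ) (σ γ : Fin r → ℝ) (σ₀ ρ w : ℝ)
      (g : (REIndex q → ℝ) → (Fin p → ℝ)) (E : Set (REIndex q → ℝ)),
      (∀ i, 0 < σ i) → (∀ i, 0 < fa (γ i)) → (∀ i, 0 < fb (γ i)) → 0 < σ₀ → 0 ≤ ρ → 0 ≤ w →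
      MeasurableSet E → (∀ u ∈ E, ‖Z *ᵥ u - X *ᵥ g u‖ ≤ ρ) →
      (∀ u ∈ E, ∀ i k, |u ⟨i, k⟩| ≤ σ i * min (fa (γ i)) (fb (γ i))) →
      ENNReal.ofReal (c * σ₀⁻¹ ^ n * Real.exp (-(C * (1 + ρ) ^ 2) / (2 * σ₀ ^ 2)) * ρ ^ p *
        (∏ i, ((σ i * (fa (γ i) + fb (γ i)))⁻¹) ^ q i) * w) * volume E ≤
      ∫⁻ β : Fin p → ℝ, ∫⁻ u : REIndex q → ℝ,
        ENNReal.ofReal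
          (normalLikelihood X Z u β σ₀ y * randomEffectsDensity fa fb σ γ u * w) := by
  obtain ⟨D, hD, hXD⟩ := X.mulVecLin.exists_norm_le
  have hφ : 0 < gaussianPDFReal 0 1 1 := gaussianPDFReal_pos _ _ _ one_ne_zero
  refine ⟨((√(2 * Real.pi))⁻¹) ^ n * (2 * gaussianPDFReal 0 1 1) ^ (∑ i, q i) * 2 ^ p,
    n * (‖y‖ + D + 1) ^ 2, by positivity, by positivity, ?_⟩
  intro fa fb σ γ σ₀ ρ w g E hσ ha hb hσ₀ hρ hw hE hEρ hEu
  rw [lintegral_likelihood_swap]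
  set A : ℝ := ((√(2 * Real.pi) * σ₀)⁻¹) ^ n *
    Real.exp (-(n * (‖y‖ + D + 1) ^ 2 * (1 + ρ) ^ 2) / (2 * σ₀ ^ 2)) *
    ((2 * gaussianPDFReal 0 1 1) ^ (∑ i, q i) *
      ∏ i, ((σ i * (fa (γ i) + fb (γ i)))⁻¹) ^ q i) * w with hA
  have hprod : 0 ≤ ∏ i, ((σ i * (fa (γ i) + fb (γ i)))⁻¹) ^ q i :=
    Finset.prod_nonneg fun i _ => pow_nonneg
      (inv_nonneg.2 (mul_nonneg (hσ i).le (add_nonneg (ha i).le (hb i).le))) _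
  have hA0 : 0 ≤ A := by positivity
  have hbound : ∀ u ∈ E, ∀ β ∈ Metric.closedBall (-g u) ρ, A ≤
      normalLikelihood X Z u β σ₀ y * randomEffectsDensity fa fb σ γ u * w := by
    intro u hu β hβ
    rw [normalLikelihood_eq X Z u β hσ₀, hA]
    rw [Metric.mem_closedBall, dist_eq_norm, sub_neg_eq_add] at hβ
    -- Since β is within ρ of -g u, the fixed effects cancel Z u up to ρ, leaving ‖y‖ + Dρ + ρ.
    have hres : ‖y - (X *ᵥ β + Z *ᵥ u)‖ ≤ (‖y‖ + D + 1) * (1 + ρ) := by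
      have e : y - (X *ᵥ β + Z *ᵥ u) = y - X *ᵥ (β + g u) - (Z *ᵥ u - X *ᵥ g u) := by
        rw [Matrix.mulVec_add]; abel
      rw [e]
      have h1 := norm_sub_le (y - X *ᵥ (β + g u)) (Z *ᵥ u - X *ᵥ g u)
      have h2 := norm_sub_le y (X *ᵥ (β + g u))
      have h3 : ‖X *ᵥ (β + g u)‖ ≤ D * ρ := (hXD _).trans (by gcongr)
      have h4 := hEρ u hu
      have h5 : 0 ≤ ‖y‖ * ρ := by positivity
      nlinarith
    have hsum : ∑ j, (y j - (X *ᵥ β + Z *ᵥ u) j) ^ 2 ≤ n * (‖y‖ + D + 1) ^ 2 * (1 + ρ) ^ 2 := by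
      have h1 := sum_sq_le_card_mul_sq_norm (y - (X *ᵥ β + Z *ᵥ u))
      rw [Fintype.card_fin] at h1
      refine h1.trans ?_
      rw [mul_assoc, ← mul_pow]
      gcongr
    gcongr
    · exact randomEffectsDensity_ge hσ ha hb (hEu u hu)
  calc _ = ENNReal.ofReal A * ENNReal.ofReal ((2 * ρ) ^ p) * volume E := by
        rw [← ENNReal.ofReal_mul hA0]
        congr 2
        rw [hA, mul_inv, mul_pow, mul_pow]
        ring
    _ = ∫⁻ _u in E, ENNReal.ofReal A * ENNReal.ofReal ((2 * ρ) ^ p) := by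
        rw [setLIntegral_const]
    _ ≤ ∫⁻ u in E, ∫⁻ β : Fin p → ℝ, ENNReal.ofReal
          (normalLikelihood X Z u β σ₀ y * randomEffectsDensity fa fb σ γ u * w) := by
        refine setLIntegral_mono' hE fun u hu => ?_
        calc _ = ∫⁻ _β in Metric.closedBall (-g u) ρ, ENNReal.ofReal A := by
              rw [setLIntegral_const, Real.volume_pi_closedBall _ hρ, Fintype.card_fin]
          _ ≤ ∫⁻ β in Metric.closedBall (-g u) ρ, ENNReal.ofReal
                (normalLikelihood X Z u β σ₀ y * randomEffectsDensity fa fb σ γ u * w) :=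
              setLIntegral_mono' Metric.isClosed_closedBall.measurableSet fun β hβ =>
                ENNReal.ofReal_le_ofReal (hbound u hu β hβ)
          _ ≤ _ := setLIntegral_le_lintegral _ _
    _ ≤ _ := setLIntegral_le_lintegral _ _

end Densities

/-! ### Gaussian integration and an upper bound for the integrated likelihood. -/

theorem lintegral_gaussianPDFReal_sq {s : ℝ} (hs : 0 < s) (μ : ℝ) :
    ∫⁻ x, ENNReal.ofReal (gaussianPDFReal μ (s ^ 2).toNNReal x) = 1 :=
  lintegral_gaussianPDFReal_eq_one μ (by simpa using hs.ne')

theorem exp_neg_sq_eq_gaussianPDFReal {s : ℝ} (hs : 0 < s) (μ x : ℝ) :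
    Real.exp (-(x - μ) ^ 2 / (2 * s ^ 2)) =
      √(2 * Real.pi) * s * gaussianPDFReal μ (s ^ 2).toNNReal x := by
  rw [gaussianPDFReal_sq_toNNReal hs]
  have : √(2 * Real.pi) * s ≠ 0 := by positivity
  field_simp

theorem lintegral_exp_neg_sq {s : ℝ} (hs : 0 < s) (μ : ℝ) :
    ∫⁻ x, ENNReal.ofReal (Real.exp (-(x - μ) ^ 2 / (2 * s ^ 2))) =
      ENNReal.ofReal (√(2 * Real.pi) * s) := by
  simp_rw [exp_neg_sq_eq_gaussianPDFReal hs,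
    ENNReal.ofReal_mul (show 0 ≤ √(2 * Real.pi) * s by positivity)]
  rw [lintegral_const_mul' _ _ ENNReal.ofReal_ne_top, lintegral_gaussianPDFReal_sq hs, mul_one]

/-- The integral of a product of a Gaussian kernel and a centred normal density. -/
theorem lintegral_exp_mul_gaussianPDFReal_le {s τ : ℝ} (hs : 0 < s) (hτ : 0 < τ) (μ : ℝ) :
    ∫⁻ x, ENNReal.ofReal (Real.exp (-(x - μ) ^ 2 / (2 * s ^ 2)) *
      gaussianPDFReal 0 (τ ^ 2).toNNReal x) ≤ ENNReal.ofReal (min 1 (s / τ)) := by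
  have hle : ∀ x : ℝ, ∀ t : ℝ, 0 < t → -x ^ 2 / (2 * t ^ 2) ≤ 0 := fun x t ht =>
    div_nonpos_of_nonpos_of_nonneg (neg_nonpos.2 (sq_nonneg _)) (by positivity)
  -- Dropping the kernel leaves a probability density, with integral 1; dropping the exponential of
  -- the density instead leaves the kernel mass √(2π)s divided by √(2π)τ.
  rw [ENNReal.ofReal_min, le_min_iff]
  constructor
  · rw [ENNReal.ofReal_one, ← lintegral_gaussianPDFReal_sq hτ 0]
    refine lintegral_mono fun x => ENNReal.ofReal_le_ofReal ?_
    exact mul_le_of_le_one_left (gaussianPDFReal_nonneg _ _ _)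
      (Real.exp_le_one_iff.2 (hle _ _ hs))
  · have h1 : 0 ≤ (√(2 * Real.pi) * τ)⁻¹ := by positivity
    calc _ ≤ ∫⁻ x, ENNReal.ofReal ((√(2 * Real.pi) * τ)⁻¹) *
          ENNReal.ofReal (Real.exp (-(x - μ) ^ 2 / (2 * s ^ 2))) := by
          refine lintegral_mono fun x => ?_
          rw [← ENNReal.ofReal_mul h1, mul_comm (Real.exp _), gaussianPDFReal_sq_toNNReal hτ]
          refine ENNReal.ofReal_le_ofReal ?_
          gcongr
          exact mul_le_of_le_one_right h1 (Real.exp_le_one_iff.2 (hle _ _ hτ))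
      _ = ENNReal.ofReal ((√(2 * Real.pi) * τ)⁻¹ * (√(2 * Real.pi) * s)) := by
          rw [lintegral_const_mul' _ _ ENNReal.ofReal_ne_top, lintegral_exp_neg_sq hs,
            ENNReal.ofReal_mul h1]
      _ ≤ _ := by
          refine ENNReal.ofReal_le_ofReal (le_of_eq ?_)
          have : √(2 * Real.pi) ≠ 0 := by positivity
          field_simp

section UpperBound

variable {n p r : ℕ} {q : Fin r → ℕ} (X : Matrix (Fin n) (Fin p) ℝ)
  (Z : Matrix (Fin n) (REIndex q) ℝ)

/-- Upper bound for the density of the data given the scale parameters under normal random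
effects. -/
theorem exists_lintegral_normal_likelihood_le {B : REIndex q → Prop} [DecidablePred B]
    (hinj : Function.Injective (columnMap X Z B)) (y : Fin n → ℝ) {θ : ℝ} (hθ0 : 0 < θ)
    (hθ1 : θ < 1) :
    ∃ c C : ℝ, 0 < c ∧ 0 < C ∧ ∀ (τ : Fin r → ℝ) (σ₀ w : ℝ), (∀ i, 0 < τ i) → 0 < σ₀ → 0 ≤ w →
      ∫⁻ β : Fin p → ℝ, ∫⁻ u : REIndex q → ℝ, ENNReal.ofReal (normalLikelihood X Z u β σ₀ y *
        (∏ k, gaussianPDFReal 0 (τ k.1 ^ 2).toNNReal (u k)) * w) ≤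
      ENNReal.ofReal (c * σ₀⁻¹ ^ n * σ₀ ^ p * Real.exp (-(θ * SSE X Z y) / (2 * σ₀ ^ 2)) *
        (∏ k : {k // B k}, min 1 (C * σ₀ / τ k.1.1)) * w) := by
  obtain ⟨κ, hκ, hres⟩ := exists_sum_sq_residual_ge hinj
  -- With s = νσ₀ the quadratic (1 - θ)κx²/(2σ₀²) becomes x²/(2s²), a Gaussian kernel of scale s.
  set ν : ℝ := (√((1 - θ) * κ))⁻¹ with hν
  have hθκ : 0 < (1 - θ) * κ := mul_pos (by linarith) hκ
  have hν0 : 0 < ν := by positivity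
  have hν2 : (1 - θ) * κ = (ν ^ 2)⁻¹ := by
    rw [hν, inv_pow, inv_inv, Real.sq_sqrt hθκ.le]
  refine ⟨((√(2 * Real.pi))⁻¹) ^ n * (√(2 * Real.pi) * ν) ^ p, ν, by positivity, hν0, ?_⟩
  intro τ σ₀ w hτ hσ₀ hw
  set G : (Fin p → ℝ) → (REIndex q → ℝ) → ℝ≥0∞ := fun β u =>
    ENNReal.ofReal (normalLikelihood X Z u β σ₀ y *
        (∏ k, gaussianPDFReal 0 (τ k.1 ^ 2).toNNReal (u k)) * w) with hG
  have hGm : Measurable (Function.uncurry G) := by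
    refine (((measurable_normalLikelihood X Z σ₀ y).mul ?_).mul_const w).ennreal_ofReal
    exact Finset.measurable_fun_prod _ fun k _ => (measurable_gaussianPDFReal 0 _).comp
      ((measurable_pi_apply k).comp measurable_snd)
  change ∫⁻ β, ∫⁻ u, G β u ≤ _
  rw [lintegral_lintegral_swap hGm.aemeasurable]
  set e := MeasurableEquiv.piEquivPiSubtypeProd (fun _ : REIndex q => ℝ) B with he
  have hmp : MeasurePreserving e.symm :=
    (volume_preserving_piEquivPiSubtypeProd (fun _ : REIndex q => ℝ) B).symm
  have hGu : Measurable fun u => ∫⁻ β, G β u := hGm.lintegral_prod_left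
  rw [← hmp.lintegral_comp hGu, Measure.volume_eq_prod,
    lintegral_prod_symm' (fun z => ∫⁻ β, G β (e.symm z)) (hGu.comp e.symm.measurable)]
  set s : ℝ := ν * σ₀ with hs
  have hs0 : 0 < s := by positivity
  set A : ℝ := ((√(2 * Real.pi) * σ₀)⁻¹) ^ n *
    Real.exp (-(θ * SSE X Z y) / (2 * σ₀ ^ 2)) * w with hA
  have hA0 : 0 ≤ A := by positivity
  set M : ℝ≥0∞ := ENNReal.ofReal A * (ENNReal.ofReal (√(2 * Real.pi) * s)) ^ p *
    ∏ k : {k // B k}, ENNReal.ofReal (min 1 (s / τ k.1.1)) with hM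
  -- The coordinates outside B are frozen and moved into the data. They only shift the centres of
  -- the Gaussian kernels, so the bound depends on b solely through its own density.
  have hinner : ∀ b : {k // ¬ B k} → ℝ, ∫⁻ a, ∫⁻ β, G β (e.symm (a, b)) ≤
      M * ∏ k : {k // ¬ B k}, ENNReal.ofReal (gaussianPDFReal 0 (τ k.1.1 ^ 2).toNNReal (b k)) := by
    intro b
    obtain ⟨β', v', hβv⟩ := hres (y - Z.submatrix id (Subtype.val : {k // ¬ B k} → _) *ᵥ b)
    have hpt : ∀ a β, G β (e.symm (a, b)) ≤ ENNReal.ofReal A *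
        (∏ k : {k // ¬ B k}, ENNReal.ofReal (gaussianPDFReal 0 (τ k.1.1 ^ 2).toNNReal (b k))) *
        ((∏ k : {k // B k}, ENNReal.ofReal (Real.exp (-(a k - v' k) ^ 2 / (2 * s ^ 2)) *
          gaussianPDFReal 0 (τ k.1.1 ^ 2).toNNReal (a k))) *
        ∏ j, ENNReal.ofReal (Real.exp (-(β j - β' j) ^ 2 / (2 * s ^ 2)))) := by
      intro a β
      have h1 : ∀ k : {k // B k}, e.symm (a, b) k = a k := fun k => by
        rw [he]; exact dif_pos k.2
      have h2 : ∀ k : {k // ¬ B k}, e.symm (a, b) k = b k := fun k => by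
        rw [he]; exact dif_neg k.2
      set u := e.symm (a, b) with hu
      have hpos : ∀ (t : ℝ) (x : ℝ), 0 ≤ gaussianPDFReal 0 (t ^ 2).toNNReal x :=
        fun t x => gaussianPDFReal_nonneg _ _ _
      rw [← ENNReal.ofReal_prod_of_nonneg fun k _ => hpos _ _,
        ← ENNReal.ofReal_prod_of_nonneg fun k _ => mul_nonneg (Real.exp_nonneg _) (hpos _ _),
        ← ENNReal.ofReal_prod_of_nonneg fun k _ => Real.exp_nonneg _,
        ← ENNReal.ofReal_mul hA0, ← ENNReal.ofReal_mul (Finset.prod_nonneg fun k _ =>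
          mul_nonneg (Real.exp_nonneg _) (hpos _ _)),
        ← ENNReal.ofReal_mul (mul_nonneg hA0 (Finset.prod_nonneg fun k _ => hpos _ _))]
      refine ENNReal.ofReal_le_ofReal ?_
      rw [← Fintype.prod_subtype_mul_prod_subtype B, Finset.prod_mul_distrib, ← Real.exp_sum,
        ← Real.exp_sum]
      simp_rw [h1, h2]
      set N₁ := ∏ k : {k // B k}, gaussianPDFReal 0 (τ k.1.1 ^ 2).toNNReal (a k) with hN₁
      set N₂ := ∏ k : {k // ¬ B k}, gaussianPDFReal 0 (τ k.1.1 ^ 2).toNNReal (b k) with hN₂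
      have hN₁0 : 0 ≤ N₁ := Finset.prod_nonneg fun k _ => hpos _ _
      have hN₂0 : 0 ≤ N₂ := Finset.prod_nonneg fun k _ => hpos _ _
      have hL : normalLikelihood X Z u β σ₀ y ≤ ((√(2 * Real.pi) * σ₀)⁻¹) ^ n *
          (Real.exp (-(θ * SSE X Z y) / (2 * σ₀ ^ 2)) *
          (Real.exp (∑ k, -(a k - v' k) ^ 2 / (2 * s ^ 2)) *
          Real.exp (∑ j, -(β j - β' j) ^ 2 / (2 * s ^ 2)))) := by
        rw [normalLikelihood_eq X Z u β hσ₀, ← Real.exp_add, ← Real.exp_add]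
        gcongr
        have hS := SSE_le X Z y β u
        set S := ∑ j, (y j - (X *ᵥ β + Z *ᵥ u) j) ^ 2 with hSdef
        have hSk : κ * (∑ j, (β j - β' j) ^ 2 + ∑ k, (a k - v' k) ^ 2) ≤ S := by
          refine (hβv β a).trans_eq (Finset.sum_congr rfl fun j _ => ?_)
          rw [mulVec_eq_add_subtype Z B u, columnMap_apply]
          simp_rw [h1, h2]
          simp only [Pi.sub_apply, Pi.add_apply]
          ring
        rw [← Finset.sum_div, ← Finset.sum_div, Finset.sum_neg_distrib, Finset.sum_neg_distrib]
        set S₁ := ∑ j, (β j - β' j) ^ 2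
        set S₂ := ∑ k, (a k - v' k) ^ 2
        have e1 : ∀ x : ℝ, -x / (2 * s ^ 2) = -((1 - θ) * κ * x) / (2 * σ₀ ^ 2) := by
          intro x
          rw [hν2, hs]
          field_simp
        rw [e1, e1, ← add_div, ← add_div]
        gcongr
        -- Splitting S = θS + (1 - θ)S, the first part is bounded below by θ·SSE and the second by
        -- the quadratic.
        have h3 : (1 - θ) * (κ * (S₁ + S₂)) ≤ (1 - θ) * S := by
          gcongr
        have h4 : θ * SSE X Z y ≤ θ * S := by gcongr
        nlinarith
      calc _ ≤ ((√(2 * Real.pi) * σ₀)⁻¹) ^ n *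
          (Real.exp (-(θ * SSE X Z y) / (2 * σ₀ ^ 2)) *
          (Real.exp (∑ k, -(a k - v' k) ^ 2 / (2 * s ^ 2)) *
          Real.exp (∑ j, -(β j - β' j) ^ 2 / (2 * s ^ 2)))) * (N₁ * N₂) * w := by gcongr
        _ = _ := by rw [hA]; ring
    have hfin : ENNReal.ofReal A *
        (∏ k : {k // ¬ B k}, ENNReal.ofReal (gaussianPDFReal 0 (τ k.1.1 ^ 2).toNNReal (b k)))
          ≠ ∞ := ENNReal.mul_ne_top ENNReal.ofReal_ne_top
      (ENNReal.prod_ne_top fun _ _ => ENNReal.ofReal_ne_top)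
    have hmexp : ∀ μ : ℝ, Measurable fun x : ℝ =>
        ENNReal.ofReal (Real.exp (-(x - μ) ^ 2 / (2 * s ^ 2))) := fun μ => by fun_prop
    have hmexp2 : ∀ μ t : ℝ, Measurable fun x : ℝ =>
        ENNReal.ofReal (Real.exp (-(x - μ) ^ 2 / (2 * s ^ 2)) *
          gaussianPDFReal 0 (t ^ 2).toNNReal x) := fun μ t => by
      have := measurable_gaussianPDFReal 0 (t ^ 2).toNNReal
      fun_prop
    calc _ ≤ ∫⁻ a : {k // B k} → ℝ, ∫⁻ β : Fin p → ℝ, _ :=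
          lintegral_mono fun a => lintegral_mono fun β => hpt a β
      _ = ENNReal.ofReal A *
        (∏ k : {k // ¬ B k}, ENNReal.ofReal (gaussianPDFReal 0 (τ k.1.1 ^ 2).toNNReal (b k))) *
        ((∏ k : {k // B k}, ∫⁻ x, ENNReal.ofReal (Real.exp (-(x - v' k) ^ 2 / (2 * s ^ 2)) *
          gaussianPDFReal 0 (τ k.1.1 ^ 2).toNNReal x)) *
        ∏ j, ∫⁻ x, ENNReal.ofReal (Real.exp (-(x - β' j) ^ 2 / (2 * s ^ 2)))) := by
          simp_rw [lintegral_const_mul' _ _ hfin]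
          congr 1
          rw [lintegral_lintegral_mul, volume_pi, volume_pi,
            lintegral_pi_prod fun k => (hmexp2 _ _).aemeasurable,
            lintegral_pi_prod fun k => (hmexp _).aemeasurable]
          · exact (Finset.measurable_fun_prod _ fun k _ =>
              (hmexp2 _ _).comp (measurable_pi_apply k)).aemeasurable
          · exact (Finset.measurable_fun_prod _ fun k _ =>
              (hmexp _).comp (measurable_pi_apply k)).aemeasurable
      _ ≤ ENNReal.ofReal A *
        (∏ k : {k // ¬ B k}, ENNReal.ofReal (gaussianPDFReal 0 (τ k.1.1 ^ 2).toNNReal (b k))) *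
        ((∏ k : {k // B k}, ENNReal.ofReal (min 1 (s / τ k.1.1))) *
          ∏ _j : Fin p, ENNReal.ofReal (√(2 * Real.pi) * s)) := by
          simp_rw [lintegral_exp_neg_sq hs0]
          gcongr with k
          exact lintegral_exp_mul_gaussianPDFReal_le hs0 (hτ _) _
      _ = _ := by
          rw [hM, Finset.prod_const, Finset.card_univ, Fintype.card_fin]
          ring
  have hone : ∫⁻ b : {k // ¬ B k} → ℝ, ∏ k : {k // ¬ B k},
      ENNReal.ofReal (gaussianPDFReal 0 (τ k.1.1 ^ 2).toNNReal (b k)) = 1 := by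
    rw [volume_pi, lintegral_pi_prod (f := fun (k : {k // ¬ B k}) x =>
      ENNReal.ofReal (gaussianPDFReal 0 (τ k.1.1 ^ 2).toNNReal x))
      fun k => (measurable_gaussianPDFReal 0 _).ennreal_ofReal.aemeasurable]
    exact Finset.prod_eq_one fun k _ => lintegral_gaussianPDFReal_sq (hτ _) 0
  have hMtop : M ≠ ∞ := ENNReal.mul_ne_top
    (ENNReal.mul_ne_top ENNReal.ofReal_ne_top (ENNReal.pow_ne_top ENNReal.ofReal_ne_top))
    (ENNReal.prod_ne_top fun _ _ => ENNReal.ofReal_ne_top)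
  refine (lintegral_mono hinner).trans ?_
  rw [lintegral_const_mul' _ _ hMtop, hone, mul_one]
  have hmin : ∀ k : {k // B k}, 0 ≤ min 1 (s / τ k.1.1) := fun k =>
    le_min zero_le_one (div_nonneg hs0.le (hτ _).le)
  rw [hM, ← ENNReal.ofReal_prod_of_nonneg fun k _ => hmin k,
    ← ENNReal.ofReal_pow (by positivity), ← ENNReal.ofReal_mul hA0,
    ← ENNReal.ofReal_mul (by positivity)]
  refine ENNReal.ofReal_le_ofReal (le_of_eq ?_)
  rw [hA, hs, mul_inv, mul_pow, mul_pow, mul_pow, mul_pow]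
  ring


end UpperBound

/-! ### Integrals over the scale parameters and choice of exponents. -/

theorem scalePrior_nonneg {a b σ : ℝ} (hσ : 0 < σ) : 0 ≤ scalePrior a b σ := (scalePrior_pos hσ).le

theorem lintegral_Ioi_zero_lt_top {f : ℝ → ℝ≥0∞} (h0 : ∫⁻ x in Ioc (0 : ℝ) 1, f x < ∞)
    (h1 : ∫⁻ x in Ioi (1 : ℝ), f x < ∞) : ∫⁻ x in Ioi (0 : ℝ), f x < ∞ := by
  rw [← Ioc_union_Ioi_eq_Ioi zero_le_one]
  exact (lintegral_union_le _ _ _).trans_lt (ENNReal.add_lt_top.2 ⟨h0, h1⟩)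

/-- A scale prior times a kernel decaying at infinity is integrable. -/
theorem lintegral_scalePrior_mul_rpow_lt_top {a b κ : ℝ} (hab : (a < b ∧ b = 0) ∨ 0 < b)
    (hκ0 : 0 ≤ κ) (hκ : 0 < κ + 2 * a) :
    ∫⁻ τ in Ioi (0 : ℝ), ENNReal.ofReal (min 1 τ⁻¹ ^ κ * scalePrior a b τ) < ∞ := by
  have hb : 0 ≤ b := by rcases hab with ⟨-, h⟩ | h <;> linarith
  refine lintegral_Ioi_zero_lt_top ?_ ?_
  · have hle : ∫⁻ τ in Ioc (0 : ℝ) 1, ENNReal.ofReal (min 1 τ⁻¹ ^ κ * scalePrior a b τ) ≤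
        ∫⁻ τ in Ioc (0 : ℝ) 1, ENNReal.ofReal (scalePrior a b τ) := by
      refine setLIntegral_mono' measurableSet_Ioc fun τ hτ => ENNReal.ofReal_le_ofReal ?_
      refine mul_le_of_le_one_left (scalePrior_nonneg hτ.1) ?_
      exact Real.rpow_le_one (le_min zero_le_one (inv_nonneg.2 hτ.1.le)) (min_le_left _ _) hκ0
    refine hle.trans_lt ?_
    rcases hab with ⟨ha, rfl⟩ | hb
    · have h := (lintegral_Ioo_rpow_lt_top_iff (s := -(2 * a + 1)) two_pos).2 (by linarith)
      refine lt_of_le_of_lt ?_ h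
      simp only [scalePrior, neg_zero, zero_div, Real.exp_zero, mul_one]
      exact lintegral_mono_set fun x hx => ⟨hx.1, hx.2.trans_lt one_lt_two⟩
    · exact lintegral_Ioc_rpow_mul_exp_lt_top hb _
  · have h := (lintegral_Ioi_rpow_lt_top_iff (s := -κ + -(2 * a + 1)) one_pos).2 (by linarith)
    refine lt_of_le_of_lt (setLIntegral_mono' measurableSet_Ioi fun τ hτ => ?_) h
    have hτ0 : 0 < τ := one_pos.trans hτ
    rw [min_eq_right (inv_le_one_of_one_le₀ (le_of_lt hτ)), Real.inv_rpow hτ0.le,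
      ← Real.rpow_neg hτ0.le, scalePrior, Real.rpow_add hτ0]
    refine ENNReal.ofReal_le_ofReal ?_
    gcongr
    refine mul_le_of_le_one_right (Real.rpow_nonneg hτ0.le _) (Real.exp_le_one_iff.2 ?_)
    exact div_nonpos_of_nonpos_of_nonneg (neg_nonpos.2 hb) (sq_nonneg _)

/-- Integrability of the scale prior against a kernel of polynomial growth. -/
theorem lintegral_rpow_mul_exp_mul_growth_lt_top {x s κ : ℝ} (hs : 0 < s) (hκ0 : 0 ≤ κ)
    (hκ : x + κ < -1) :
    ∫⁻ σ in Ioi (0 : ℝ), ENNReal.ofReal ((1 + σ) ^ κ * (σ ^ x * Real.exp (-s / σ ^ 2))) < ∞ := by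
  refine lintegral_Ioi_zero_lt_top ?_ ?_
  · have h := ENNReal.mul_lt_top (ENNReal.ofReal_lt_top (r := 2 ^ κ))
      (lintegral_Ioc_rpow_mul_exp_lt_top hs x)
    rw [← lintegral_const_mul' _ _ ENNReal.ofReal_ne_top] at h
    refine lt_of_le_of_lt (setLIntegral_mono' measurableSet_Ioc fun σ hσ => ?_) h
    rw [← ENNReal.ofReal_mul (by positivity)]
    have h0 := hσ.1
    have h1 := hσ.2
    refine ENNReal.ofReal_le_ofReal ?_
    gcongr
    linarith
  · have h := ENNReal.mul_lt_top (ENNReal.ofReal_lt_top (r := 2 ^ κ))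
      ((lintegral_Ioi_rpow_lt_top_iff (s := x + κ) one_pos).2 hκ)
    rw [← lintegral_const_mul' _ _ ENNReal.ofReal_ne_top] at h
    refine lt_of_le_of_lt (setLIntegral_mono' measurableSet_Ioi fun σ hσ => ?_) h
    rw [← ENNReal.ofReal_mul (by positivity)]
    have h1 : 1 < σ := hσ
    have h0 : 0 < σ := one_pos.trans h1
    refine ENNReal.ofReal_le_ofReal ?_
    calc (1 + σ) ^ κ * (σ ^ x * Real.exp (-s / σ ^ 2))
        ≤ (2 * σ) ^ κ * (σ ^ x * 1) := by
          gcongr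
          · linarith
          · exact Real.exp_le_one_iff.2
              (div_nonpos_of_nonpos_of_nonneg (neg_nonpos.2 hs.le) (sq_nonneg _))
      _ = 2 ^ κ * σ ^ (x + κ) := by
          rw [Real.mul_rpow two_pos.le h0.le, Real.rpow_add h0]; ring

/-- The base is at most 1, so lowering the exponent from m to κ only increases the power; then
min(1, Cσ₀/τ) ≤ max(1, C)(1 + σ₀)min(1, 1/τ) separates σ₀ from τ. -/
theorem min_one_div_pow_le {C σ₀ τ κ : ℝ} {m : ℕ} (hC : 0 < C) (hσ₀ : 0 < σ₀) (hτ : 0 < τ)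
    (hκ0 : 0 ≤ κ) (hκm : κ ≤ m) :
    min 1 (C * σ₀ / τ) ^ m ≤ max 1 C ^ κ * (1 + σ₀) ^ κ * min 1 τ⁻¹ ^ κ := by
  have hm0 : 0 < min 1 (C * σ₀ / τ) := lt_min one_pos (by positivity)
  have hm1 : 0 < min 1 τ⁻¹ := lt_min one_pos (by positivity)
  have h1 : min 1 (C * σ₀ / τ) ≤ max 1 C * (1 + σ₀) * min 1 τ⁻¹ := by
    have hD : 1 ≤ max 1 C := le_max_left _ _
    have hD' : C ≤ max 1 C := le_max_right _ _
    rcases le_total 1 τ⁻¹ with h | h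
    · rw [min_eq_left h, mul_one]
      refine (min_le_left _ _).trans ?_
      nlinarith
    · rw [min_eq_right h]
      refine (min_le_right _ _).trans ?_
      rw [div_eq_mul_inv]
      gcongr
      linarith
  rw [← Real.rpow_natCast]
  calc min 1 (C * σ₀ / τ) ^ (m : ℝ) ≤ min 1 (C * σ₀ / τ) ^ κ :=
        Real.rpow_le_rpow_of_exponent_ge hm0 (min_le_left _ _) hκm
    _ ≤ (max 1 C * (1 + σ₀) * min 1 τ⁻¹) ^ κ := by gcongr
    _ = _ := by
      rw [Real.mul_rpow (by positivity) hm1.le, Real.mul_rpow (by positivity) (by positivity)]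

/-- The exponent must exceed -2a to give decay in τ, yet stay close to -2 min(0, a), because the sum
of the exponents is the growth in σ₀ that the likelihood has to absorb. -/
theorem exists_decay_exponent {m a ε : ℝ} (hm : 0 ≤ m) (ha : 0 < m + 2 * a) (hε : 0 < ε) :
    ∃ κ, 0 ≤ κ ∧ κ ≤ m ∧ 0 < κ + 2 * a ∧ κ ≤ -(2 * min 0 a) + ε := by
  rcases lt_or_ge 0 a with h | h
  · exact ⟨0, le_rfl, hm, by linarith, by rw [min_eq_left h.le]; linarith⟩
  · refine ⟨min m (-(2 * a) + ε), le_min hm (by linarith), min_le_left _ _, ?_, ?_⟩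
    · rcases min_choice m (-(2 * a) + ε) with h' | h' <;> rw [h'] <;> linarith
    · rw [min_eq_right h]; exact min_le_right _ _

/-- The integral of the scale prior against a kernel in `σ * H`. -/
theorem lintegral_scalePrior_mul_le {a b κ H M : ℝ} (hb : 0 ≤ b) (hM : 0 < M) (hMH : M ≤ H) :
    ∫⁻ σ in Ioi (0 : ℝ), ENNReal.ofReal (min 1 (σ * H)⁻¹ ^ κ * scalePrior a b σ) ≤
      ENNReal.ofReal (H ^ (2 * a)) *
        ∫⁻ τ in Ioi (0 : ℝ), ENNReal.ofReal (min 1 τ⁻¹ ^ κ * scalePrior a (b * M ^ 2) τ) := by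
  have hH : 0 < H := hM.trans_le hMH
  rw [← lintegral_Ioi_comp_mul_right hH
    fun τ => ENNReal.ofReal (min 1 τ⁻¹ ^ κ * scalePrior a (b * M ^ 2) τ), ← mul_assoc,
    ← ENNReal.ofReal_mul (Real.rpow_nonneg hH.le _),
    ← lintegral_const_mul' _ _ ENNReal.ofReal_ne_top]
  refine setLIntegral_mono' measurableSet_Ioi fun σ hσ => ?_
  have hσ : 0 < σ := hσ
  rw [← ENNReal.ofReal_mul (by positivity)]
  refine ENNReal.ofReal_le_ofReal ?_
  -- The substitution τ = σH has Jacobian H, and the power of the prior scales by H^(-(2a+1)); the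
  -- balance is H^(2a).
  have h1 : H ^ (2 * a) * H * (σ * H) ^ (-(2 * a + 1)) = σ ^ (-(2 * a + 1)) := by
    rw [Real.mul_rpow hσ.le hH.le, ← Real.rpow_add_one hH.ne', mul_left_comm,
      ← Real.rpow_add hH, add_neg_cancel, Real.rpow_zero, mul_one]
  have h2 : -b / σ ^ 2 ≤ -(b * M ^ 2) / (σ * H) ^ 2 := by
    rw [neg_div, neg_div, neg_le_neg_iff, div_le_div_iff₀ (by positivity) (by positivity)]
    have : M ^ 2 ≤ H ^ 2 := by gcongr
    rw [mul_pow]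
    have h3 : 0 ≤ b * σ ^ 2 := by positivity
    nlinarith
  have hm : 0 ≤ min 1 (σ * H)⁻¹ := le_min zero_le_one (by positivity)
  calc min 1 (σ * H)⁻¹ ^ κ * scalePrior a b σ
      ≤ min 1 (σ * H)⁻¹ ^ κ * (σ ^ (-(2 * a + 1)) * Real.exp (-(b * M ^ 2) / (σ * H) ^ 2)) := by
        unfold scalePrior; gcongr
    _ = _ := by rw [← h1, scalePrior]; ring

theorem prod_subtype_sigma_fst {r : ℕ} {q : Fin r → ℕ} (B : REIndex q → Prop) [DecidablePred B]
    (f : Fin r → ℝ) :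
    ∏ k : {k // B k}, f k.1.1 = ∏ i, f i ^ Fintype.card {k : Fin (q i) // B ⟨i, k⟩} := by
  have h : ∏ k : {k // B k}, f k.1.1 = ∏ k : REIndex q, if B k then f k.1 else 1 := by
    rw [← Finset.prod_filter]
    exact (Finset.prod_subtype _ (by simp) fun k : REIndex q => f k.1).symm
  rw [h, Fintype.prod_sigma]
  refine Finset.prod_congr rfl fun i _ => ?_
  rw [← Finset.prod_filter, Fintype.card_subtype]
  exact Finset.prod_const (f i)

/-- The unselected indices of one block are among all unselected indices. When t columns are
selected, block i thus keeps at least q_i - (q - t) of them, which is what (b2) is matched against.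
-/
theorem le_card_block_add {r : ℕ} {q : Fin r → ℕ} (B : REIndex q → Prop) [DecidablePred B]
    (i : Fin r) :
    q i + Fintype.card {k // B k} ≤
      Fintype.card {k : Fin (q i) // B ⟨i, k⟩} + ∑ l, q l := by
  have h1 : Fintype.card {k : Fin (q i) // ¬ B ⟨i, k⟩} ≤ Fintype.card {k // ¬ B k} :=
    Fintype.card_le_of_injective (fun k => ⟨⟨i, k.1⟩, k.2⟩) fun k l h => by
      simpa [Subtype.ext_iff] using h
  have h2 := Fintype.card_subtype_compl fun k : Fin (q i) => B ⟨i, k⟩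
  have h3 := Fintype.card_subtype_compl B
  have h4 := Fintype.card_subtype_le fun k : Fin (q i) => B ⟨i, k⟩
  have h5 := Fintype.card_subtype_le B
  have h6 : Fintype.card (REIndex q) = ∑ l, q l := by simp
  rw [Fintype.card_fin] at h2 h4
  omega

/-- The constant b may be negative, so the retained fraction θ of the residual must be close enough
to 1 for the total exponent to stay positive. -/
theorem exists_mul_lt_one_pos {b S : ℝ} (hS : 0 ≤ S) (h : 0 < 2 * b + S) :
    ∃ θ, 0 < θ ∧ θ < 1 ∧ 0 < b + θ * S / 2 := by
  -- The second entry of the minimum makes the loss (1 - θ)S at most half of 2b + S; the entry 1/2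
  -- keeps θ positive.
  refine ⟨1 - min (1 / 2) ((2 * b + S) / (2 * (S + 1))), ?_, ?_, ?_⟩
  · have := min_le_left (1 / 2) ((2 * b + S) / (2 * (S + 1)))
    linarith
  · have : 0 < min (1 / 2) ((2 * b + S) / (2 * (S + 1))) := lt_min (by norm_num) (by positivity)
    linarith
  · have h1 := min_le_right (1 / 2) ((2 * b + S) / (2 * (S + 1)))
    have h2 : min (1 / 2) ((2 * b + S) / (2 * (S + 1))) * S ≤ (2 * b + S) / 2 := by
      calc _ ≤ (2 * b + S) / (2 * (S + 1)) * S := by gcongr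
        _ ≤ (2 * b + S) / (2 * (S + 1)) * (S + 1) := by gcongr; linarith
        _ = _ := by field_simp
    linarith

/-! ### Finiteness of the marginal likelihood under (a), (b2), (c2), (e). -/

section Finiteness

variable {n p r : ℕ} {q : Fin r → ℕ} (X : Matrix (Fin n) (Fin p) ℝ)
  (Z : Matrix (Fin n) (REIndex q) ℝ)

/-- Bound for the marginal density of the data given the skewness parameters. -/
theorem exists_inner_marginal_le (hX : X.rank = p) {a₀ b₀ M : ℝ} {a b : Fin r → ℝ} (hM : 0 < M)
    (hA : CondA a b) (hB : CondB2 q (residualRank X Z) a) (hC : CondC2 n p a₀ a)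
    {y : Fin n → ℝ} (hy : 0 < 2 * b₀ + SSE X Z y) :
    ∃ D : ℝ≥0∞, D < ∞ ∧ ∀ (fa fb : ℝ → ℝ) (γ : Fin r → ℝ), (∀ i, 0 < fa (γ i)) →
      (∀ i, 0 < fb (γ i)) → (∀ i, M ≤ fa (γ i) + fb (γ i)) →
      (∫⁻ σ in Set.univ.pi (fun _ : Fin r => Ioi (0 : ℝ)), ∫⁻ σ₀ in Ioi (0 : ℝ),
        ∫⁻ β : Fin p → ℝ, ∫⁻ u : REIndex q → ℝ,
          ENNReal.ofReal (normalLikelihood X Z u β σ₀ y * randomEffectsDensity fa fb σ γ u *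
            (scalePrior a₀ b₀ σ₀ * ∏ i, scalePrior (a i) (b i) (σ i)))) ≤
      D * ∏ i, ENNReal.ofReal ((fa (γ i) + fb (γ i)) ^ (2 * a i)) := by
  have hb : ∀ i, 0 ≤ b i := fun i => by rcases hA i with ⟨-, h⟩ | h <;> linarith
  obtain ⟨B, hBdec, hcard, hinj, -⟩ := exists_complementary_columns Z hX
  have hcard' : Fintype.card {k // B k} = residualRank X Z := hcard
  set m : Fin r → ℕ := fun i => Fintype.card {k : Fin (q i) // B ⟨i, k⟩} with hm
  have hma : ∀ i, 0 < (m i : ℝ) + 2 * a i := fun i => by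
    have h1 := hB i
    have h2 : ((q i + Fintype.card {k // B k} : ℕ) : ℝ) ≤ ((m i + ∑ l, q l : ℕ) : ℝ) :=
      Nat.cast_le.2 (le_card_block_add B i)
    rw [hcard', Nat.cast_add, Nat.cast_add] at h2
    linarith
  obtain ⟨θ, hθ0, hθ1, hθ⟩ := exists_mul_lt_one_pos (SSE_nonneg X Z y) hy
  obtain ⟨c, C, hc, hC0, hK⟩ := exists_lintegral_normal_likelihood_le X Z hinj y hθ0 hθ1
  set Δ : ℝ := (n : ℝ) - p + 2 * a₀ + 2 * ∑ i, min 0 (a i) with hΔ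
  have hΔ0 : 0 < Δ := hC
  -- Sharing the slack of (c2) among r + 1 parts keeps the sum of r excesses strictly below Δ, also
  -- for r = 0.
  have hε : 0 < Δ / (r + 1) := by positivity
  choose κ hκ0 hκm hκa hκε using fun i => exists_decay_exponent (Nat.cast_nonneg (m i)) (hma i) hε
  have hκsum : ∑ i, κ i < n - p + 2 * a₀ := by
    calc ∑ i, κ i ≤ ∑ i, (-(2 * min 0 (a i)) + Δ / (r + 1)) := Finset.sum_le_sum fun i _ => hκε i
      _ = -(2 * ∑ i, min 0 (a i)) + r * (Δ / (r + 1)) := by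
        rw [Finset.sum_add_distrib, Finset.sum_neg_distrib, ← Finset.mul_sum]; simp
      _ < -(2 * ∑ i, min 0 (a i)) + Δ := by
        gcongr
        rw [mul_div_assoc', div_lt_iff₀ (by positivity)]
        nlinarith
      _ = _ := by rw [hΔ]; ring
  set A : ℝ := 2 ^ (∑ i, q i) * c * ∏ i, max 1 C ^ κ i with hAdef
  have hA0 : 0 ≤ A := by positivity
  -- The powers of σ₀ come from the likelihood (-n), the integration over β (+p) and the prior; s
  -- below joins b₀ to the retained part of the residual.
  set x : ℝ := -(n : ℝ) + p + -(2 * a₀ + 1) with hx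
  set s : ℝ := b₀ + θ * SSE X Z y / 2 with hs
  set W : ℝ → ℝ := fun σ₀ => (1 + σ₀) ^ (∑ i, κ i) * (σ₀ ^ x * Real.exp (-s / σ₀ ^ 2)) with hW
  set J : Fin r → ℝ≥0∞ := fun i => ∫⁻ τ in Ioi (0 : ℝ),
    ENNReal.ofReal (min 1 τ⁻¹ ^ κ i * scalePrior (a i) (b i * M ^ 2) τ) with hJ
  have hJtop : ∀ i, J i < ∞ := fun i => by
    refine lintegral_scalePrior_mul_rpow_lt_top ?_ (hκ0 i) (hκa i)
    rcases hA i with ⟨h, h'⟩ | h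
    · exact Or.inl ⟨by rw [h', zero_mul]; linarith, by rw [h', zero_mul]⟩
    · exact Or.inr (by positivity)
  have hWtop : ∫⁻ σ₀ in Ioi (0 : ℝ), ENNReal.ofReal (W σ₀) < ∞ :=
    lintegral_rpow_mul_exp_mul_growth_lt_top hθ (Finset.sum_nonneg fun i _ => hκ0 i)
      (by rw [hx]; linarith)
  refine ⟨ENNReal.ofReal A * (∫⁻ σ₀ in Ioi (0 : ℝ), ENNReal.ofReal (W σ₀)) * ∏ i, J i,
    ENNReal.mul_lt_top (ENNReal.mul_lt_top ENNReal.ofReal_lt_top hWtop)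
      (ENNReal.prod_lt_top fun i _ => hJtop i), ?_⟩
  intro fa fb γ ha0 hb0 hMH
  set H : Fin r → ℝ := fun i => fa (γ i) + fb (γ i) with hH
  have hH0 : ∀ i, 0 < H i := fun i => hM.trans_le (hMH i)
  set V : Fin r → ℝ → ℝ := fun i σ =>
    min 1 (σ * H i)⁻¹ ^ κ i * scalePrior (a i) (b i) σ with hV
  have hV0 : ∀ i σ, 0 < σ → 0 ≤ V i σ := fun i σ hσ => mul_nonneg
    (Real.rpow_nonneg (le_min zero_le_one (inv_nonneg.2 (mul_nonneg hσ.le (hH0 i).le))) _)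
    (scalePrior_nonneg hσ)
  have hVm : ∀ i, Measurable (V i) := fun i => by
    have := measurable_scalePrior (a i) (b i)
    fun_prop
  have hpt : ∀ σ ∈ Set.univ.pi (fun _ : Fin r => Ioi (0 : ℝ)), ∀ σ₀ ∈ Ioi (0 : ℝ),
      (∫⁻ β : Fin p → ℝ, ∫⁻ u : REIndex q → ℝ,
        ENNReal.ofReal (normalLikelihood X Z u β σ₀ y * randomEffectsDensity fa fb σ γ u *
          (scalePrior a₀ b₀ σ₀ * ∏ i, scalePrior (a i) (b i) (σ i)))) ≤
      ENNReal.ofReal A * (∏ i, ENNReal.ofReal (V i (σ i))) * ENNReal.ofReal (W σ₀) := by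
    intro σ hσ σ₀ hσ₀
    have hσ : ∀ i, 0 < σ i := fun i => hσ i (mem_univ i)
    have hσ₀ : 0 < σ₀ := hσ₀
    have hw : 0 ≤ scalePrior a₀ b₀ σ₀ * ∏ i, scalePrior (a i) (b i) (σ i) :=
      mul_nonneg (scalePrior_nonneg hσ₀) (Finset.prod_nonneg fun i _ => scalePrior_nonneg (hσ i))
    have hτ : ∀ i, 0 < σ i * H i := fun i => mul_pos (hσ i) (hH0 i)
    refine le_trans (lintegral_mono fun β => lintegral_mono fun u => ENNReal.ofReal_le_ofReal ?_)
      ((hK (fun i => σ i * H i) σ₀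
        (2 ^ (∑ i, q i) * (scalePrior a₀ b₀ σ₀ * ∏ i, scalePrior (a i) (b i) (σ i))) hτ hσ₀
        (by positivity)).trans ?_)
    · have h1 := randomEffectsDensity_le (q := q) hσ ha0 hb0 u
      have h2 := normalLikelihood_nonneg X Z u β σ₀ y
      calc _ ≤ normalLikelihood X Z u β σ₀ y * (2 ^ (∑ i, q i) *
            ∏ k : REIndex q, gaussianPDFReal 0 ((σ k.1 * H k.1) ^ 2).toNNReal (u k)) *
            (scalePrior a₀ b₀ σ₀ * ∏ i, scalePrior (a i) (b i) (σ i)) := by gcongr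
        _ = _ := by ring
    · rw [← ENNReal.ofReal_prod_of_nonneg fun i _ => hV0 i _ (hσ i), ← ENNReal.ofReal_mul hA0,
        ← ENNReal.ofReal_mul (mul_nonneg hA0 (Finset.prod_nonneg fun i _ => hV0 i _ (hσ i)))]
      refine ENNReal.ofReal_le_ofReal ?_
      rw [prod_subtype_sigma_fst B fun i => min 1 (C * σ₀ / (σ i * H i))]
      have hprod : ∏ i, min 1 (C * σ₀ / (σ i * H i)) ^ m i ≤
          (∏ i, max 1 C ^ κ i) * (1 + σ₀) ^ (∑ i, κ i) * ∏ i, min 1 (σ i * H i)⁻¹ ^ κ i := by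
        rw [Real.rpow_sum_of_pos (by positivity), ← Finset.prod_mul_distrib,
          ← Finset.prod_mul_distrib]
        exact Finset.prod_le_prod (fun i _ => pow_nonneg (le_min zero_le_one
          (div_nonneg (by positivity) (hτ i).le)) _)
          fun i _ => min_one_div_pow_le hC0 hσ₀ (hτ i) (hκ0 i) (hκm i)
      have hpow : σ₀⁻¹ ^ n * σ₀ ^ p * Real.exp (-(θ * SSE X Z y) / (2 * σ₀ ^ 2)) *
          scalePrior a₀ b₀ σ₀ = σ₀ ^ x * Real.exp (-s / σ₀ ^ 2) := by
        have e1 : -s / σ₀ ^ 2 = -(θ * SSE X Z y) / (2 * σ₀ ^ 2) + -b₀ / σ₀ ^ 2 := by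
          rw [hs]; field_simp; ring
        rw [e1, Real.exp_add, hx, Real.rpow_add hσ₀, Real.rpow_add hσ₀, Real.rpow_neg hσ₀.le,
          Real.rpow_natCast, Real.rpow_natCast, scalePrior, inv_pow]
        ring
      calc _ ≤ c * σ₀⁻¹ ^ n * σ₀ ^ p * Real.exp (-(θ * SSE X Z y) / (2 * σ₀ ^ 2)) *
            ((∏ i, max 1 C ^ κ i) * (1 + σ₀) ^ (∑ i, κ i) * ∏ i, min 1 (σ i * H i)⁻¹ ^ κ i) *
            (2 ^ (∑ i, q i) *
              (scalePrior a₀ b₀ σ₀ * ∏ i, scalePrior (a i) (b i) (σ i))) := by gcongr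
        _ = A * (∏ i, V i (σ i)) * ((1 + σ₀) ^ (∑ i, κ i) *
            (σ₀⁻¹ ^ n * σ₀ ^ p * Real.exp (-(θ * SSE X Z y) / (2 * σ₀ ^ 2)) *
              scalePrior a₀ b₀ σ₀)) := by
          rw [hV, hAdef, Finset.prod_mul_distrib]; ring
        _ = _ := by rw [hpow]
  calc _ ≤ ∫⁻ σ in Set.univ.pi (fun _ : Fin r => Ioi (0 : ℝ)), ∫⁻ σ₀ in Ioi (0 : ℝ),
        ENNReal.ofReal A * (∏ i, ENNReal.ofReal (V i (σ i))) * ENNReal.ofReal (W σ₀) :=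
        setLIntegral_mono' (MeasurableSet.univ_pi fun _ => measurableSet_Ioi) fun σ hσ =>
          setLIntegral_mono' measurableSet_Ioi fun σ₀ hσ₀ => hpt σ hσ σ₀ hσ₀
    _ = ENNReal.ofReal A * (∫⁻ σ₀ in Ioi (0 : ℝ), ENNReal.ofReal (W σ₀)) *
        ∏ i, ∫⁻ σ in Ioi (0 : ℝ), ENNReal.ofReal (V i σ) := by
        have hfin : ∀ σ : Fin r → ℝ,
            ENNReal.ofReal A * (∏ i, ENNReal.ofReal (V i (σ i))) ≠ ∞ := fun σ =>
          ENNReal.mul_ne_top ENNReal.ofReal_ne_top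
            (ENNReal.prod_ne_top fun _ _ => ENNReal.ofReal_ne_top)
        simp_rw [lintegral_const_mul' _ _ (hfin _)]
        rw [lintegral_mul_const' _ _ hWtop.ne, lintegral_const_mul' _ _ ENNReal.ofReal_ne_top,
          volume_pi, setLIntegral_pi_prod (fun _ : Fin r => Ioi (0 : ℝ))
            (f := fun i σ => ENNReal.ofReal (V i σ))
            fun i => (hVm i).ennreal_ofReal.aemeasurable]
        ring
    _ ≤ ENNReal.ofReal A * (∫⁻ σ₀ in Ioi (0 : ℝ), ENNReal.ofReal (W σ₀)) *
        ∏ i, (ENNReal.ofReal (H i ^ (2 * a i)) * J i) := by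
        gcongr with i
        exact lintegral_scalePrior_mul_le (hb i) hM (hMH i)
    _ = _ := by rw [Finset.prod_mul_distrib]; ring

theorem marginalLikelihood_lt_top (hX : X.rank = p) {Γ : Set ℝ} (hΓ : MeasurableSet Γ)
    {fa fb : ℝ → ℝ} (hfa : ∀ γ ∈ Γ, 0 < fa γ) (hfb : ∀ γ ∈ Γ, 0 < fb γ)
    (hca : ContinuousOn fa Γ) (hcb : ContinuousOn fb Γ) {prior : Fin r → Measure ℝ}
    [∀ i, IsProbabilityMeasure (prior i)] {M : ℝ} (hM : 0 < M) (hMH : ∀ γ ∈ Γ, M < fa γ + fb γ)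
    {a₀ b₀ : ℝ} {a b : Fin r → ℝ} (hA : CondA a b) (hB : CondB2 q (residualRank X Z) a)
    (hC : CondC2 n p a₀ a) (hE : CondE Γ fa fb prior a)
    {y : Fin n → ℝ} (hy : 0 < 2 * b₀ + SSE X Z y) :
    marginalLikelihood X Z Γ fa fb prior a₀ b₀ a b y < ∞ := by
  obtain ⟨D, hD, hle⟩ := exists_inner_marginal_le X Z hX hM hA hB hC hy
  have hmeas : MeasurableSet (Set.univ.pi fun _ : Fin r => Γ) := MeasurableSet.univ_pi fun _ => hΓ
  calc _ ≤ ∫⁻ γ in Set.univ.pi (fun _ : Fin r => Γ),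
        D * ∏ i, ENNReal.ofReal ((fa (γ i) + fb (γ i)) ^ (2 * a i)) ∂(Measure.pi prior) :=
        setLIntegral_mono' hmeas fun γ hγ => hle fa fb γ (fun i => hfa _ (hγ i (mem_univ i)))
          (fun i => hfb _ (hγ i (mem_univ i))) fun i => (hMH _ (hγ i (mem_univ i))).le
    _ = D * ∏ i, ∫⁻ γ in Γ, ENNReal.ofReal ((fa γ + fb γ) ^ (2 * a i)) ∂(prior i) := by
        rw [lintegral_const_mul' _ _ hD.ne, setLIntegral_pi_prod (fun _ : Fin r => Γ)
          (f := fun i γ => ENNReal.ofReal ((fa γ + fb γ) ^ (2 * a i)))]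
        exact fun i =>
          (((hca.aemeasurable hΓ).add (hcb.aemeasurable hΓ)).pow_const _).ennreal_ofReal
    _ < ∞ := ENNReal.mul_lt_top hD hE

end Finiteness

/-! ### Lower bounds and necessity of (a), (b1), (c1). -/

theorem setLIntegral_Ioi_ofReal_pos {f : ℝ → ℝ} {t : ℝ} (hf : Measurable f)
    (hpos : ∀ x, t < x → 0 < f x) : 0 < ∫⁻ x in Ioi t, ENNReal.ofReal (f x) := by
  rw [setLIntegral_pos_iff hf.ennreal_ofReal]
  have h : Ioi t ⊆ Function.support (fun x => ENNReal.ofReal (f x)) ∩ Ioi t := fun x hx =>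
    ⟨by simpa using hpos x hx, hx⟩
  exact lt_of_lt_of_le (by simp) (measure_mono h)

theorem ENNReal.lt_top_of_prod_lt_top {ι : Type*} [Fintype ι] {f : ι → ℝ≥0∞}
    (h : ∏ i, f i < ∞) (h0 : ∀ i, f i ≠ 0) (i : ι) : f i < ∞ := by
  classical
  rw [← Finset.mul_prod_erase _ _ (Finset.mem_univ i)] at h
  exact ENNReal.lt_top_of_mul_ne_top_left h.ne (Finset.prod_ne_zero_iff.2 fun j _ => h0 j)

/-- For σ ≥ 1 the exponential factor lies above a positive constant whatever the sign of b, so the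
tail is governed by the power. -/
theorem scalePrior_ge {a b σ : ℝ} (hσ : 1 ≤ σ) :
    Real.exp (-|b|) * σ ^ (-(2 * a + 1)) ≤ scalePrior a b σ := by
  have h0 : 0 < σ := one_pos.trans_le hσ
  rw [scalePrior, mul_comm]
  gcongr
  have h1 : b / σ ^ 2 ≤ |b| := by
    rw [div_le_iff₀ (by positivity)]
    have : (1 : ℝ) ≤ σ ^ 2 := one_le_pow₀ hσ
    nlinarith [le_abs_self b, abs_nonneg b]
  rw [neg_div]
  linarith

theorem rpow_ge_of_mem_Ioc {σ₀ σ x : ℝ} (hσ₀ : 0 < σ₀) (h : σ ∈ Ioc σ₀ (2 * σ₀)) :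
    2 ^ (-|x|) * σ₀ ^ x ≤ σ ^ x := by
  have ht1 : 1 ≤ σ / σ₀ := by rw [one_le_div hσ₀]; exact h.1.le
  have ht2 : σ / σ₀ ≤ 2 := by rw [div_le_iff₀ hσ₀]; exact h.2
  have e : σ = σ / σ₀ * σ₀ := (div_mul_cancel₀ _ hσ₀.ne').symm
  rw [e, Real.mul_rpow (by linarith) hσ₀.le]
  gcongr
  calc (2 : ℝ) ^ (-|x|) ≤ (σ / σ₀) ^ (-|x|) :=
        Real.rpow_le_rpow_of_nonpos (by linarith) ht2 (neg_nonpos.2 (abs_nonneg _))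
    _ ≤ (σ / σ₀) ^ x := Real.rpow_le_rpow_of_exponent_le ht1 (neg_abs_le x)

section LowerBound

variable {n p r : ℕ} {q : Fin r → ℕ} (X : Matrix (Fin n) (Fin p) ℝ)
  (Z : Matrix (Fin n) (REIndex q) ℝ)

/-- The marginal density of the data given the skewness parameters, up to a constant. -/
noncomputable def conditionalMarginal (fa fb : ℝ → ℝ) (a₀ b₀ : ℝ) (a b : Fin r → ℝ) (y : Fin n → ℝ)
    (γ : Fin r → ℝ) : ℝ≥0∞ :=
  ∫⁻ σ in Set.univ.pi (fun _ : Fin r => Ioi (0 : ℝ)), ∫⁻ σ₀ in Ioi (0 : ℝ),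
    ∫⁻ β : Fin p → ℝ, ∫⁻ u : REIndex q → ℝ,
      ENNReal.ofReal (normalLikelihood X Z u β σ₀ y * randomEffectsDensity fa fb σ γ u *
        (scalePrior a₀ b₀ σ₀ * ∏ i, scalePrior (a i) (b i) (σ i)))

/-- A separable lower bound of the integrand gives a lower bound of the conditional marginal. -/
theorem conditionalMarginal_ge_of_separable {fa fb : ℝ → ℝ} {a₀ b₀ : ℝ} {a b : Fin r → ℝ}
    {y : Fin n → ℝ} {γ : Fin r → ℝ} {W : ℝ → ℝ} {V : Fin r → ℝ → ℝ} (hV : ∀ i, Measurable (V i))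
    (s : Fin r → Set ℝ) (hs : ∀ i, MeasurableSet (s i)) (hs0 : ∀ i, s i ⊆ Ioi 0)
    (h : ∀ σ, (∀ i, σ i ∈ s i) → ∀ σ₀, 0 < σ₀ →
      ENNReal.ofReal (W σ₀) * ∏ i, ENNReal.ofReal (V i (σ i)) ≤
      ∫⁻ β : Fin p → ℝ, ∫⁻ u : REIndex q → ℝ,
        ENNReal.ofReal (normalLikelihood X Z u β σ₀ y * randomEffectsDensity fa fb σ γ u *
          (scalePrior a₀ b₀ σ₀ * ∏ i, scalePrior (a i) (b i) (σ i)))) :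
    (∫⁻ σ₀ in Ioi (0 : ℝ), ENNReal.ofReal (W σ₀)) *
      ∏ i, ∫⁻ σ in s i, ENNReal.ofReal (V i σ) ≤
      conditionalMarginal X Z fa fb a₀ b₀ a b y γ := by
  calc _ = (∫⁻ σ₀ in Ioi (0 : ℝ), ENNReal.ofReal (W σ₀)) *
        ∫⁻ σ in Set.univ.pi s, ∏ i, ENNReal.ofReal (V i (σ i)) := by
        rw [volume_pi, setLIntegral_pi_prod s (f := fun i σ => ENNReal.ofReal (V i σ))
          fun i => (hV i).ennreal_ofReal.aemeasurable]
    _ ≤ ∫⁻ σ in Set.univ.pi s,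
        (∫⁻ σ₀ in Ioi (0 : ℝ), ENNReal.ofReal (W σ₀)) * ∏ i, ENNReal.ofReal (V i (σ i)) :=
        lintegral_const_mul_le _ _
    _ = ∫⁻ σ in Set.univ.pi s, ∫⁻ σ₀ in Ioi (0 : ℝ),
        ENNReal.ofReal (W σ₀) * ∏ i, ENNReal.ofReal (V i (σ i)) := by
        refine lintegral_congr fun σ => ?_
        rw [lintegral_mul_const' _ _ (ENNReal.prod_ne_top fun _ _ => ENNReal.ofReal_ne_top)]
    _ ≤ ∫⁻ σ in Set.univ.pi s, ∫⁻ σ₀ in Ioi (0 : ℝ), _ :=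
        setLIntegral_mono' (MeasurableSet.univ_pi hs) fun σ hσ =>
          setLIntegral_mono' measurableSet_Ioi fun σ₀ hσ₀ =>
            h σ (fun i => hσ i (mem_univ i)) σ₀ hσ₀
    _ ≤ _ := lintegral_mono_set (Set.pi_mono fun i _ => hs0 i)

/-- Lower bound of the conditional marginal from random effects in a box around zero. -/
theorem exists_conditionalMarginal_ge (a₀ b₀ : ℝ) (a b : Fin r → ℝ) (y : Fin n → ℝ) :
    ∃ c : ℝ≥0∞, c ≠ 0 ∧ ∀ (fa fb : ℝ → ℝ) (γ : Fin r → ℝ), (∀ i, 0 < fa (γ i)) →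
      (∀ i, 0 < fb (γ i)) →
      c * ∏ i, ∫⁻ σ in Ioi (0 : ℝ), ENNReal.ofReal
        ((min 1 (σ * min (fa (γ i)) (fb (γ i))) * (σ * (fa (γ i) + fb (γ i)))⁻¹) ^ q i *
          scalePrior (a i) (b i) σ) ≤
      conditionalMarginal X Z fa fb a₀ b₀ a b y γ := by
  obtain ⟨c, C, hc, hC, hK⟩ := exists_lintegral_likelihood_ge X Z y
  obtain ⟨D, hD, hZD⟩ := Z.mulVecLin.exists_norm_le
  -- In the box ‖u‖ ≤ 1, hence ‖Zu‖ ≤ D: the choice ρ = D, g = 0 makes the σ₀ factor independent of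
  -- σ and γ.
  set W : ℝ → ℝ := fun σ₀ => c * σ₀⁻¹ ^ n *
    Real.exp (-(C * (1 + D) ^ 2) / (2 * σ₀ ^ 2)) * D ^ p * scalePrior a₀ b₀ σ₀ with hW
  have hWpos : ∀ σ₀, 0 < σ₀ → 0 < W σ₀ := fun σ₀ hσ₀ => by
    have := scalePrior_pos (a := a₀) (b := b₀) hσ₀
    positivity
  have hWm : Measurable W := by
    have := measurable_scalePrior a₀ b₀
    fun_prop
  refine ⟨_, (setLIntegral_Ioi_ofReal_pos hWm hWpos).ne', fun fa fb γ ha hb => ?_⟩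
  refine conditionalMarginal_ge_of_separable X Z (fun i => ?_) _ (fun i => measurableSet_Ioi)
    (fun i => subset_rfl) fun σ hσ σ₀ hσ₀ => ?_
  · have := measurable_scalePrior (a i) (b i)
    fun_prop
  have hσ : ∀ i, 0 < σ i := hσ
  set d : Fin r → ℝ := fun i => min 1 (σ i * min (fa (γ i)) (fb (γ i))) with hd
  have hd0 : ∀ i, 0 < d i := fun i => lt_min one_pos (mul_pos (hσ i) (lt_min (ha i) (hb i)))
  have hHi : ∀ i, 0 < (σ i * (fa (γ i) + fb (γ i)))⁻¹ := fun i =>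
    inv_pos.2 (mul_pos (hσ i) (add_pos (ha i) (hb i)))
  have hw : 0 ≤ scalePrior a₀ b₀ σ₀ * ∏ i, scalePrior (a i) (b i) (σ i) :=
    mul_nonneg (scalePrior_nonneg hσ₀) (Finset.prod_nonneg fun i _ => scalePrior_nonneg (hσ i))
  set E : Set (REIndex q → ℝ) := Set.univ.pi fun k => Icc (-d k.1) (d k.1) with hE
  have habs : ∀ u ∈ E, ∀ k, |u k| ≤ d k.1 := fun u hu k => abs_le.2 (hu k (mem_univ k))
  have hvol : volume E = ENNReal.ofReal (∏ i, (2 * d i) ^ q i) := by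
    rw [hE, volume_pi, Measure.pi_pi, Fintype.prod_sigma,
      ENNReal.ofReal_prod_of_nonneg fun i _ => pow_nonneg (by linarith [hd0 i]) _]
    refine Finset.prod_congr rfl fun i _ => ?_
    simp only [Real.volume_Icc, sub_neg_eq_add, Finset.prod_const, Finset.card_univ,
      Fintype.card_fin]
    rw [ENNReal.ofReal_pow (by linarith [hd0 i]), two_mul]
  refine le_trans ?_ (hK fa fb σ γ σ₀ D _ (fun _ => 0) E hσ ha hb hσ₀ hD.le hw
    (MeasurableSet.univ_pi fun _ => measurableSet_Icc) (fun u hu => ?_) fun u hu i k => ?_)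
  · rw [hvol, ← ENNReal.ofReal_prod_of_nonneg fun i _ =>
      mul_nonneg (pow_nonneg (mul_nonneg (hd0 i).le (hHi i).le) _) (scalePrior_nonneg (hσ i)),
      ← ENNReal.ofReal_mul (hWpos σ₀ hσ₀).le]
    have hprod : 0 ≤ ∏ i, ((σ i * (fa (γ i) + fb (γ i)))⁻¹) ^ q i :=
      Finset.prod_nonneg fun i _ => pow_nonneg (hHi i).le _
    rw [← ENNReal.ofReal_mul (by positivity)]
    refine ENNReal.ofReal_le_ofReal ?_
    have hS : 0 ≤ ∏ i, scalePrior (a i) (b i) (σ i) :=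
      Finset.prod_nonneg fun i _ => scalePrior_nonneg (hσ i)
    have h2 : ∏ i, d i ^ q i ≤ ∏ i, (2 * d i) ^ q i := by
      refine Finset.prod_le_prod (fun i _ => pow_nonneg (hd0 i).le _) fun i _ => ?_
      have := (hd0 i).le
      gcongr
      linarith
    calc _ = W σ₀ * ((∏ i, ((σ i * (fa (γ i) + fb (γ i)))⁻¹) ^ q i) *
          ∏ i, scalePrior (a i) (b i) (σ i)) * ∏ i, d i ^ q i := by
          simp_rw [mul_pow, Finset.prod_mul_distrib]; ring
      _ ≤ W σ₀ * ((∏ i, ((σ i * (fa (γ i) + fb (γ i)))⁻¹) ^ q i) *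
          ∏ i, scalePrior (a i) (b i) (σ i)) * ∏ i, (2 * d i) ^ q i := by
          have := (hWpos σ₀ hσ₀).le
          gcongr
      _ = _ := by rw [hW]; ring
  · rw [Matrix.mulVec_zero, sub_zero]
    refine (hZD u).trans (mul_le_of_le_one_right hD.le ?_)
    exact (pi_norm_le_iff_of_nonneg zero_le_one).2 fun k =>
      (habs u hu k).trans (min_le_left _ _)
  · exact (habs u hu ⟨i, k⟩).trans (min_le_right _ _)

variable {fa fb : ℝ → ℝ} {a₀ b₀ : ℝ} {a b : Fin r → ℝ} {y : Fin n → ℝ} {γ : Fin r → ℝ}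

/-- All factors of the product bound are nonzero, so a finite product makes each one finite. -/
theorem lintegral_boxKernel_lt_top (ha : ∀ i, 0 < fa (γ i)) (hb : ∀ i, 0 < fb (γ i))
    (h : conditionalMarginal X Z fa fb a₀ b₀ a b y γ < ∞) (i : Fin r) :
    ∫⁻ σ in Ioi (0 : ℝ), ENNReal.ofReal
      ((min 1 (σ * min (fa (γ i)) (fb (γ i))) * (σ * (fa (γ i) + fb (γ i)))⁻¹) ^ q i *
        scalePrior (a i) (b i) σ) < ∞ := by
  obtain ⟨c, hc, hle⟩ := exists_conditionalMarginal_ge X Z a₀ b₀ a b y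
  have h1 := (hle fa fb γ ha hb).trans_lt h
  refine ENNReal.lt_top_of_prod_lt_top (ENNReal.lt_top_of_mul_ne_top_right h1.ne hc)
    (fun j => (setLIntegral_Ioi_ofReal_pos ?_ fun σ hσ => ?_).ne') i
  · have := measurable_scalePrior (a j) (b j)
    fun_prop
  · have h2 := scalePrior_pos (a := a j) (b := b j) hσ
    have h3 : 0 < min 1 (σ * min (fa (γ j)) (fb (γ j))) :=
      lt_min one_pos (mul_pos hσ (lt_min (ha j) (hb j)))
    have h4 := add_pos (ha j) (hb j)
    positivity

/-- For σ < 1/h the box kernel is the constant (h/H)^q_i times the prior, so the prior itself must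
be integrable at zero. -/
theorem condA_of_conditionalMarginal_lt_top (ha : ∀ i, 0 < fa (γ i)) (hb : ∀ i, 0 < fb (γ i))
    (h : conditionalMarginal X Z fa fb a₀ b₀ a b y γ < ∞) : CondA a b := by
  intro i
  have h1 := lintegral_boxKernel_lt_top X Z ha hb h i
  set m := min (fa (γ i)) (fb (γ i)) with hm
  set H := fa (γ i) + fb (γ i) with hH
  have hm0 : 0 < m := lt_min (ha i) (hb i)
  have hH0 : 0 < H := add_pos (ha i) (hb i)
  refine cond_of_lintegral_scalePrior_lt_top (inv_pos.2 hm0) ?_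
  have hpos : 0 < (m / H) ^ q i := by positivity
  refine ENNReal.lt_top_of_mul_ne_top_right (a := ENNReal.ofReal ((m / H) ^ q i))
    (lt_of_le_of_lt ?_ h1).ne (by simpa using hpos)
  rw [← lintegral_const_mul' _ _ ENNReal.ofReal_ne_top]
  refine le_trans (setLIntegral_mono' measurableSet_Ioo fun σ hσ => ?_)
    (lintegral_mono_set (s := Ioo 0 m⁻¹) fun σ hσ => hσ.1)
  rw [← ENNReal.ofReal_mul hpos.le]
  have hσ0 : 0 < σ := hσ.1
  have h2 : σ * m ≤ 1 := by
    rw [← inv_mul_cancel₀ hm0.ne']; gcongr; exact hσ.2.le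
  rw [min_eq_right h2]
  refine ENNReal.ofReal_le_ofReal (le_of_eq ?_)
  congr 2
  field_simp

/-- For large σ the box no longer grows and the kernel decays like σ^(-q_i - 2a_i - 1), whose
integrability at infinity is the claim. -/
theorem condB1_of_conditionalMarginal_lt_top (ha : ∀ i, 0 < fa (γ i)) (hb : ∀ i, 0 < fb (γ i))
    (h : conditionalMarginal X Z fa fb a₀ b₀ a b y γ < ∞) : CondB1 q a := by
  intro i
  have h1 := lintegral_boxKernel_lt_top X Z ha hb h i
  set m := min (fa (γ i)) (fb (γ i)) with hm
  set H := fa (γ i) + fb (γ i) with hH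
  have hm0 : 0 < m := lt_min (ha i) (hb i)
  have hH0 : 0 < H := add_pos (ha i) (hb i)
  have ht : 0 < max 1 m⁻¹ := lt_max_of_lt_left one_pos
  have hpos : 0 < H⁻¹ ^ q i * Real.exp (-|b i|) := by positivity
  have h2 : ∫⁻ σ in Ioi (max 1 m⁻¹), ENNReal.ofReal (σ ^ (-(q i : ℝ) + -(2 * a i + 1))) < ∞ := by
    refine ENNReal.lt_top_of_mul_ne_top_right (a := ENNReal.ofReal (H⁻¹ ^ q i * Real.exp (-|b i|)))
      (lt_of_le_of_lt ?_ h1).ne (by simpa using hpos)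
    rw [← lintegral_const_mul' _ _ ENNReal.ofReal_ne_top]
    refine le_trans (setLIntegral_mono' measurableSet_Ioi fun σ hσ => ?_)
      (lintegral_mono_set (s := Ioi (max 1 m⁻¹)) fun σ hσ => ht.trans hσ)
    rw [← ENNReal.ofReal_mul hpos.le]
    have hσ1 : 1 < σ := (le_max_left _ _).trans_lt hσ
    have hσm : m⁻¹ < σ := (le_max_right _ _).trans_lt hσ
    have hσ0 : 0 < σ := one_pos.trans hσ1
    have h2 : 1 ≤ σ * m := by
      rw [← inv_mul_cancel₀ hm0.ne']; gcongr
    rw [min_eq_left h2, one_mul]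
    refine ENNReal.ofReal_le_ofReal ?_
    calc _ = (σ * H)⁻¹ ^ q i * (Real.exp (-|b i|) * σ ^ (-(2 * a i + 1))) := by
          rw [Real.rpow_add hσ0, Real.rpow_neg hσ0.le, Real.rpow_natCast, mul_inv, mul_pow,
            inv_pow σ]
          ring
      _ ≤ _ := by
          gcongr
          exact scalePrior_ge hσ1.le
  rw [lintegral_Ioi_rpow_lt_top_iff ht] at h2
  linarith

theorem exists_pos_le {ι : Type*} [Fintype ι] {f : ι → ℝ} (hf : ∀ i, 0 < f i) :
    ∃ δ : ℝ, 0 < δ ∧ δ ≤ 1 ∧ ∀ i, δ ≤ f i := by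
  have h0 : 0 ≤ ∑ i, (f i)⁻¹ := Finset.sum_nonneg fun i _ => (inv_pos.2 (hf i)).le
  refine ⟨(1 + ∑ i, (f i)⁻¹)⁻¹, by positivity, inv_le_one_of_one_le₀ (by linarith), fun i => ?_⟩
  rw [inv_le_comm₀ (by positivity) (hf i)]
  have := Finset.single_le_sum (f := fun i => (f i)⁻¹) (fun i _ => (inv_pos.2 (hf i)).le)
    (Finset.mem_univ i)
  linarith

/-- All scales are taken comparable, σ₀ < σ_i ≤ 2σ₀ with σ₀ > 1, and u, β of size σ₀. The densities
of u then cancel the volume of their range, and a pure power of σ₀ remains. -/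
theorem condC1_of_conditionalMarginal_lt_top (ha : ∀ i, 0 < fa (γ i)) (hb : ∀ i, 0 < fb (γ i))
    (h : conditionalMarginal X Z fa fb a₀ b₀ a b y γ < ∞) : CondC1 n p a₀ a := by
  obtain ⟨c, C, hc, hC, hK⟩ := exists_lintegral_likelihood_ge X Z y
  obtain ⟨D, hD, hZD⟩ := Z.mulVecLin.exists_norm_le
  obtain ⟨δ, hδ, hδ1, hδm⟩ := exists_pos_le fun i => lt_min (ha i) (hb i)
  set N := ∑ i, q i with hN
  set A : ℝ := c * Real.exp (-(C * (1 + D) ^ 2) / 2) * D ^ p *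
    (∏ i, ((2 * (fa (γ i) + fb (γ i)))⁻¹) ^ q i) *
    (Real.exp (-|b₀|) * ∏ i, (Real.exp (-|b i|) * 2 ^ (-|(-(2 * a i + 1))|))) * (2 * δ) ^ N with hA
  have hHi : ∀ i, 0 < (2 * (fa (γ i) + fb (γ i)))⁻¹ := fun i =>
    inv_pos.2 (mul_pos two_pos (add_pos (ha i) (hb i)))
  have hprod : 0 < ∏ i, ((2 * (fa (γ i) + fb (γ i)))⁻¹) ^ q i :=
    Finset.prod_pos fun i _ => pow_pos (hHi i) _
  have hprod2 : 0 < ∏ i, (Real.exp (-|b i|) * (2 : ℝ) ^ (-|(-(2 * a i + 1))|)) :=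
    Finset.prod_pos fun i _ => by positivity
  have hA0 : 0 < A := by positivity
  set z : ℝ := -(n : ℝ) + p + -(2 * a₀ + 1) + ∑ i, -(2 * a i + 1) with hz
  set S : Set ((Fin r → ℝ) × ℝ) := {x | ∀ i, x.2 < x.1 i ∧ x.1 i ≤ 2 * x.2} with hS
  have hSm : MeasurableSet S := by
    rw [hS, ofPred_forall]
    refine MeasurableSet.iInter fun i => ?_
    exact (measurableSet_lt measurable_snd ((measurable_pi_apply i).comp measurable_fst)).inter
      (measurableSet_le ((measurable_pi_apply i).comp measurable_fst) (measurable_snd.const_mul 2))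
  -- An explicit jointly measurable minorant allows the order of σ and σ₀ to be exchanged, so that σ
  -- can be integrated over a region depending on σ₀.
  set F : (Fin r → ℝ) → ℝ → ℝ≥0∞ := fun σ σ₀ =>
    S.indicator (fun x => ENNReal.ofReal (A * x.2 ^ z)) (σ, σ₀) with hF
  have hFm : Measurable (Function.uncurry F) :=
    Measurable.indicator (by fun_prop) hSm
  have hpt : ∀ σ σ₀, 1 < σ₀ → F σ σ₀ ≤ ∫⁻ β : Fin p → ℝ, ∫⁻ u : REIndex q → ℝ,
        ENNReal.ofReal (normalLikelihood X Z u β σ₀ y * randomEffectsDensity fa fb σ γ u *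
          (scalePrior a₀ b₀ σ₀ * ∏ i, scalePrior (a i) (b i) (σ i))) := by
    intro σ σ₀ h1
    by_cases hmem : (σ, σ₀) ∈ S
    swap
    · simp [hF, hmem]
    rw [hF]
    simp only [indicator_of_mem hmem]
    have hσ₀ : 0 < σ₀ := one_pos.trans h1
    have hlt : ∀ i, σ₀ < σ i := fun i => (hmem i).1
    have hle : ∀ i, σ i ≤ 2 * σ₀ := fun i => (hmem i).2
    have hσ : ∀ i, 0 < σ i := fun i => hσ₀.trans (hlt i)
    have hw : 0 ≤ scalePrior a₀ b₀ σ₀ * ∏ i, scalePrior (a i) (b i) (σ i) :=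
      mul_nonneg (scalePrior_nonneg hσ₀) (Finset.prod_nonneg fun i _ => scalePrior_nonneg (hσ i))
    have hball : ∀ u ∈ Metric.closedBall (0 : REIndex q → ℝ) (δ * σ₀), ‖u‖ ≤ δ * σ₀ :=
      fun u hu => by simpa using hu
    -- A β-ball of radius Dσ₀ contributes σ₀^p, while (1 + Dσ₀)²/σ₀² stays bounded for σ₀ > 1, so
    -- the exponential costs only a constant.
    refine le_trans ?_ (hK fa fb σ γ σ₀ (D * σ₀) _ (fun _ => 0)
      (Metric.closedBall 0 (δ * σ₀)) hσ ha hb hσ₀ (by positivity) hw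
      Metric.isClosed_closedBall.measurableSet (fun u hu => ?_) fun u hu i k => ?_)
    · rw [Real.volume_pi_closedBall _ (by positivity)]
      have hHσ : ∀ i, 0 < (σ i * (fa (γ i) + fb (γ i)))⁻¹ := fun i =>
        inv_pos.2 (mul_pos (hσ i) (add_pos (ha i) (hb i)))
      have hprod3 : 0 ≤ ∏ i, ((σ i * (fa (γ i) + fb (γ i)))⁻¹) ^ q i :=
        Finset.prod_nonneg fun i _ => pow_nonneg (hHσ i).le _
      rw [← ENNReal.ofReal_mul (by positivity)]
      refine ENNReal.ofReal_le_ofReal ?_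
      have hcard : Fintype.card (REIndex q) = N := by simp [hN]
      rw [hcard]
      have e1 : -(C * (1 + D) ^ 2) / 2 ≤ -(C * (1 + D * σ₀) ^ 2) / (2 * σ₀ ^ 2) := by
        rw [neg_div, neg_div, neg_le_neg_iff, div_le_div_iff₀ (by positivity) (by positivity)]
        have : 1 + D * σ₀ ≤ (1 + D) * σ₀ := by nlinarith
        have : (1 + D * σ₀) ^ 2 ≤ ((1 + D) * σ₀) ^ 2 := by gcongr
        calc C * (1 + D * σ₀) ^ 2 * 2 ≤ C * ((1 + D) * σ₀) ^ 2 * 2 := by gcongr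
          _ = _ := by ring
      have e2 : (∏ i, ((2 * (fa (γ i) + fb (γ i)))⁻¹) ^ q i) * σ₀⁻¹ ^ N ≤
          ∏ i, ((σ i * (fa (γ i) + fb (γ i)))⁻¹) ^ q i := by
        rw [hN, ← Finset.prod_pow_eq_pow_sum, ← Finset.prod_mul_distrib]
        refine Finset.prod_le_prod (fun i _ => mul_nonneg (pow_nonneg (hHi i).le _)
          (by positivity)) fun i _ => ?_
        rw [← mul_pow, ← mul_inv]
        have h3 := add_pos (ha i) (hb i)
        have h4 := hσ i
        refine pow_le_pow_left₀ (by positivity) (inv_anti₀ (by positivity) ?_) _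
        nlinarith [hle i]
      have e3 : Real.exp (-|b₀|) * σ₀ ^ (-(2 * a₀ + 1)) ≤ scalePrior a₀ b₀ σ₀ :=
        scalePrior_ge h1.le
      have e4 : (∏ i, (Real.exp (-|b i|) * 2 ^ (-|(-(2 * a i + 1))|))) *
          σ₀ ^ (∑ i, -(2 * a i + 1)) ≤ ∏ i, scalePrior (a i) (b i) (σ i) := by
        rw [Real.rpow_sum_of_pos hσ₀, ← Finset.prod_mul_distrib]
        refine Finset.prod_le_prod (fun i _ => by positivity) fun i _ => ?_
        refine le_trans ?_ (scalePrior_ge (h1.trans (hlt i)).le)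
        rw [mul_assoc]
        gcongr
        exact rpow_ge_of_mem_Ioc hσ₀ ⟨hlt i, hle i⟩
      have e5 : σ₀ ^ z = σ₀⁻¹ ^ n * σ₀ ^ p * σ₀ ^ (-(2 * a₀ + 1)) *
          σ₀ ^ (∑ i, -(2 * a i + 1)) * (σ₀⁻¹ ^ N * σ₀ ^ N) := by
        rw [← mul_pow, inv_mul_cancel₀ hσ₀.ne', one_pow, mul_one, hz, Real.rpow_add hσ₀,
          Real.rpow_add hσ₀, Real.rpow_add hσ₀, Real.rpow_neg hσ₀.le, Real.rpow_natCast,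
          Real.rpow_natCast, inv_pow]
      have hsp := scalePrior_nonneg (a := a₀) (b := b₀) hσ₀
      calc A * σ₀ ^ z = c * σ₀⁻¹ ^ n * Real.exp (-(C * (1 + D) ^ 2) / 2) * (D * σ₀) ^ p *
            ((∏ i, ((2 * (fa (γ i) + fb (γ i)))⁻¹) ^ q i) * σ₀⁻¹ ^ N) *
            ((Real.exp (-|b₀|) * σ₀ ^ (-(2 * a₀ + 1))) *
              ((∏ i, (Real.exp (-|b i|) * 2 ^ (-|(-(2 * a i + 1))|))) *
                σ₀ ^ (∑ i, -(2 * a i + 1)))) * (2 * (δ * σ₀)) ^ N := by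
            rw [e5, hA]; simp only [mul_pow]; ring
        _ ≤ _ := by gcongr
    · rw [Matrix.mulVec_zero, sub_zero]
      refine (hZD u).trans ?_
      gcongr
      exact (hball u hu).trans (mul_le_of_le_one_left hσ₀.le hδ1)
    · calc |u ⟨i, k⟩| ≤ ‖u‖ := norm_le_pi_norm u ⟨i, k⟩
        _ ≤ δ * σ₀ := hball u hu
        _ ≤ min (fa (γ i)) (fb (γ i)) * σ i := by
          gcongr
          · exact (lt_min (ha i) (hb i)).le
          · exact hδm i
          · exact (hlt i).le
        _ = _ := mul_comm _ _
  -- The σ-region has volume σ₀^r, which raises the exponent from z to z + r and cancels the -1 of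
  -- each of the r priors.
  have h2 : ENNReal.ofReal A * ∫⁻ σ₀ in Ioi (1 : ℝ), ENNReal.ofReal (σ₀ ^ (z + r)) < ∞ := by
    refine lt_of_le_of_lt ?_ h
    calc _ = ∫⁻ σ₀ in Ioi (1 : ℝ), ENNReal.ofReal (A * σ₀ ^ z) * ENNReal.ofReal σ₀ ^ r := by
          rw [← lintegral_const_mul' _ _ ENNReal.ofReal_ne_top]
          refine setLIntegral_congr_fun measurableSet_Ioi fun σ₀ hσ₀ => ?_
          have hσ₀ : 0 < σ₀ := one_pos.trans hσ₀
          rw [← ENNReal.ofReal_pow hσ₀.le, ← ENNReal.ofReal_mul hA0.le,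
            ← ENNReal.ofReal_mul (by positivity), Real.rpow_add hσ₀, Real.rpow_natCast, ← mul_assoc A]
      _ ≤ ∫⁻ σ₀ in Ioi (1 : ℝ), ∫⁻ σ in Set.univ.pi (fun _ : Fin r => Ioi (0 : ℝ)), F σ σ₀ := by
          refine setLIntegral_mono' measurableSet_Ioi fun σ₀ hσ₀ => ?_
          have hσ₀ : 0 < σ₀ := one_pos.trans hσ₀
          calc _ = ∫⁻ _σ in Set.univ.pi (fun _ : Fin r => Ioc σ₀ (2 * σ₀)),
                ENNReal.ofReal (A * σ₀ ^ z) := by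
                rw [setLIntegral_const, volume_pi, Measure.pi_pi]
                simp [two_mul]
            _ = ∫⁻ σ in Set.univ.pi (fun _ : Fin r => Ioc σ₀ (2 * σ₀)), F σ σ₀ := by
                refine setLIntegral_congr_fun (MeasurableSet.univ_pi fun _ => measurableSet_Ioc)
                  fun σ hσ => ?_
                have hmem : (σ, σ₀) ∈ S := fun i => hσ i (mem_univ i)
                simp only [hF, indicator_of_mem hmem]
            _ ≤ _ := lintegral_mono_set (Set.pi_mono fun i _ x hx => hσ₀.trans hx.1)
      _ = ∫⁻ σ in Set.univ.pi (fun _ : Fin r => Ioi (0 : ℝ)), ∫⁻ σ₀ in Ioi (1 : ℝ), F σ σ₀ :=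
          (lintegral_lintegral_swap hFm.aemeasurable).symm
      _ ≤ _ := by
          refine lintegral_mono fun σ => ?_
          exact (setLIntegral_mono' measurableSet_Ioi fun σ₀ hσ₀ => hpt σ σ₀ hσ₀).trans
            (lintegral_mono_set (Ioi_subset_Ioi zero_le_one))
  have h3 := ENNReal.lt_top_of_mul_ne_top_right h2.ne (by simpa using hA0)
  rw [lintegral_Ioi_rpow_lt_top_iff one_pos, hz, Finset.sum_neg_distrib, Finset.sum_add_distrib,
    ← Finset.mul_sum] at h3
  simp only [Finset.sum_const, Finset.card_univ, Fintype.card_fin, nsmul_eq_mul, mul_one] at h3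
  unfold CondC1
  linarith

end LowerBound

/-! ### Necessity of (d) and positivity of the marginal likelihood. -/

/-- Rescaling the box kernel by the smaller of the two scales `m`. -/
theorem exists_lintegral_boxKernel_ge {a b M : ℝ} (hb : 0 ≤ b) (N : ℕ) :
    ∃ c : ℝ≥0∞, c ≠ 0 ∧ ∀ m H : ℝ, 0 < m → m ≤ M → 0 < H →
      c * ENNReal.ofReal (m ^ ((N : ℝ) + 2 * a) / H ^ N) ≤
        ∫⁻ σ in Ioi (0 : ℝ),
          ENNReal.ofReal ((min 1 (σ * m) * (σ * H)⁻¹) ^ N * scalePrior a b σ) := by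
  -- Under τ = σm the exponent of the prior becomes -bm²/τ²; replacing m by its bound M, which needs
  -- b ≥ 0, frees the constant from m and H.
  refine ⟨∫⁻ τ in Ioi (0 : ℝ), ENNReal.ofReal ((min 1 τ * τ⁻¹) ^ N * scalePrior a (b * M ^ 2) τ),
    (setLIntegral_Ioi_ofReal_pos ?_ fun τ hτ => ?_).ne', fun m H hm hmM hH => ?_⟩
  · have := measurable_scalePrior a (b * M ^ 2)
    fun_prop
  · have h1 := scalePrior_pos (a := a) (b := b * M ^ 2) hτ
    have h2 : 0 < min 1 τ := lt_min one_pos hτ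
    positivity
  rw [← lintegral_Ioi_comp_mul_right hm
    fun τ => ENNReal.ofReal ((min 1 τ * τ⁻¹) ^ N * scalePrior a (b * M ^ 2) τ),
    mul_comm, ← mul_assoc, ← ENNReal.ofReal_mul (by positivity),
    ← lintegral_const_mul' _ _ ENNReal.ofReal_ne_top]
  refine setLIntegral_mono' measurableSet_Ioi fun σ hσ => ?_
  have hσ : 0 < σ := hσ
  rw [← ENNReal.ofReal_mul (by positivity)]
  refine ENNReal.ofReal_le_ofReal ?_
  have h1 : m ^ (2 * a) * m * (σ * m) ^ (-(2 * a + 1)) = σ ^ (-(2 * a + 1)) := by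
    rw [Real.mul_rpow hσ.le hm.le, ← Real.rpow_add_one hm.ne', mul_left_comm,
      ← Real.rpow_add hm, add_neg_cancel, Real.rpow_zero, mul_one]
  have h2 : -(b * M ^ 2) / (σ * m) ^ 2 ≤ -b / σ ^ 2 := by
    rw [neg_div, neg_div, neg_le_neg_iff, div_le_div_iff₀ (by positivity) (by positivity)]
    have : m ^ 2 ≤ M ^ 2 := by gcongr
    rw [mul_pow]
    have h3 : 0 ≤ b * σ ^ 2 := by positivity
    nlinarith
  have h3 : 0 < min 1 (σ * m) := lt_min one_pos (by positivity)
  calc m ^ ((N : ℝ) + 2 * a) / H ^ N * m *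
        ((min 1 (σ * m) * (σ * m)⁻¹) ^ N * scalePrior a (b * M ^ 2) (σ * m))
      = (min 1 (σ * m) * (σ * H)⁻¹) ^ N * ((m ^ (2 * a) * m * (σ * m) ^ (-(2 * a + 1))) *
          Real.exp (-(b * M ^ 2) / (σ * m) ^ 2)) := by
        rw [scalePrior, Real.rpow_add hm, Real.rpow_natCast]
        simp only [mul_pow, inv_pow]
        field_simp
    _ ≤ _ := by rw [h1, scalePrior]; gcongr

section LowerBound

variable {n p r : ℕ} {q : Fin r → ℕ} (X : Matrix (Fin n) (Fin p) ℝ)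
  (Z : Matrix (Fin n) (REIndex q) ℝ) {Γ : Set ℝ} {fa fb : ℝ → ℝ} {prior : Fin r → Measure ℝ}
  {a₀ b₀ : ℝ} {a b : Fin r → ℝ} {y : Fin n → ℝ}

theorem marginalLikelihood_eq : marginalLikelihood X Z Γ fa fb prior a₀ b₀ a b y =
    ∫⁻ γ in Set.univ.pi (fun _ : Fin r => Γ), conditionalMarginal X Z fa fb a₀ b₀ a b y γ
      ∂(Measure.pi prior) := rfl

/-- The marginal likelihood dominates the integrals in condition (d). -/
theorem exists_marginalLikelihood_ge (hΓ : MeasurableSet Γ) (hfa : ∀ γ ∈ Γ, 0 < fa γ)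
    (hfb : ∀ γ ∈ Γ, 0 < fb γ) (hca : ContinuousOn fa Γ) (hcb : ContinuousOn fb Γ)
    [∀ i, IsProbabilityMeasure (prior i)] {M : ℝ} (hM : ∀ γ ∈ Γ, min (fa γ) (fb γ) < M)
    (hA : CondA a b) (y : Fin n → ℝ) :
    ∃ c : ℝ≥0∞, c ≠ 0 ∧ c * ∏ i, (∫⁻ γ in Γ, ENNReal.ofReal
      ((min (fa γ) (fb γ)) ^ ((q i : ℝ) + 2 * a i) / (fa γ + fb γ) ^ (q i)) ∂(prior i)) ≤
      marginalLikelihood X Z Γ fa fb prior a₀ b₀ a b y := by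
  have hb : ∀ i, 0 ≤ b i := fun i => by rcases hA i with ⟨-, h⟩ | h <;> linarith
  obtain ⟨c, hc, hle⟩ := exists_conditionalMarginal_ge X Z a₀ b₀ a b y
  choose k hk hkle using fun i => exists_lintegral_boxKernel_ge (a := a i) (M := M) (hb i) (q i)
  refine ⟨c * ∏ i, k i, mul_ne_zero hc (Finset.prod_ne_zero_iff.2 fun i _ => hk i), ?_⟩
  have hma := fun i => hca.aemeasurable hΓ (μ := prior i)
  have hmb := fun i => hcb.aemeasurable hΓ (μ := prior i)
  calc _ = (c * ∏ i, k i) * ∫⁻ γ in Set.univ.pi (fun _ : Fin r => Γ), ∏ i, ENNReal.ofReal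
        ((min (fa (γ i)) (fb (γ i))) ^ ((q i : ℝ) + 2 * a i) / (fa (γ i) + fb (γ i)) ^ (q i))
        ∂(Measure.pi prior) := by
        rw [setLIntegral_pi_prod (fun _ : Fin r => Γ) (f := fun i γ => ENNReal.ofReal
          ((min (fa γ) (fb γ)) ^ ((q i : ℝ) + 2 * a i) / (fa γ + fb γ) ^ (q i)))]
        exact fun i => ((((hma i).min (hmb i)).pow_const _).div
          (((hma i).add (hmb i)).pow_const _)).ennreal_ofReal
    _ ≤ ∫⁻ γ in Set.univ.pi (fun _ : Fin r => Γ), (c * ∏ i, k i) * ∏ i, ENNReal.ofReal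
        ((min (fa (γ i)) (fb (γ i))) ^ ((q i : ℝ) + 2 * a i) / (fa (γ i) + fb (γ i)) ^ (q i))
        ∂(Measure.pi prior) := lintegral_const_mul_le _ _
    _ ≤ _ := by
        rw [marginalLikelihood_eq]
        refine setLIntegral_mono' (MeasurableSet.univ_pi fun _ => hΓ) fun γ hγ => ?_
        have ha0 : ∀ i, 0 < fa (γ i) := fun i => hfa _ (hγ i (mem_univ i))
        have hb0 : ∀ i, 0 < fb (γ i) := fun i => hfb _ (hγ i (mem_univ i))
        refine le_trans ?_ (hle fa fb γ ha0 hb0)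
        rw [mul_assoc, ← Finset.prod_mul_distrib]
        gcongr with i
        exact hkle i _ _ (lt_min (ha0 i) (hb0 i)) (hM _ (hγ i (mem_univ i))).le
          (add_pos (ha0 i) (hb0 i))

/-- The lower bound is a product of integrals of strictly positive functions against probability
measures carried by Γ. -/
theorem marginalLikelihood_pos (hΓ : MeasurableSet Γ) (hfa : ∀ γ ∈ Γ, 0 < fa γ)
    (hfb : ∀ γ ∈ Γ, 0 < fb γ) (hca : ContinuousOn fa Γ) (hcb : ContinuousOn fb Γ)
    [∀ i, IsProbabilityMeasure (prior i)] (hprior : ∀ i, prior i Γᶜ = 0)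
    {M : ℝ} (hM : ∀ γ ∈ Γ, min (fa γ) (fb γ) < M) (hA : CondA a b) (y : Fin n → ℝ) :
    0 < marginalLikelihood X Z Γ fa fb prior a₀ b₀ a b y := by
  obtain ⟨c, hc, hle⟩ := exists_marginalLikelihood_ge X Z (a₀ := a₀) (b₀ := b₀) (prior := prior)
    hΓ hfa hfb hca hcb hM hA y
  refine lt_of_lt_of_le (pos_iff_ne_zero.2 (mul_ne_zero hc (Finset.prod_ne_zero_iff.2
    fun i _ => ?_))) hle
  have hma := hca.aemeasurable hΓ (μ := prior i)
  have hmb := hcb.aemeasurable hΓ (μ := prior i)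
  have hm : AEMeasurable (fun γ => ENNReal.ofReal
      ((min (fa γ) (fb γ)) ^ ((q i : ℝ) + 2 * a i) / (fa γ + fb γ) ^ (q i)))
      ((prior i).restrict Γ) := (((hma.min hmb).pow_const _).div
          ((hma.add hmb).pow_const _)).ennreal_ofReal
  intro h0
  rw [lintegral_eq_zero_iff' hm, Filter.EventuallyEq, ae_restrict_iff' hΓ] at h0
  have hΓ1 : ∀ᵐ γ ∂(prior i), γ ∈ Γ := hprior i
  have hfalse : ∀ᵐ _γ ∂(prior i), False := by
    filter_upwards [h0, hΓ1] with γ h hγ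
    have h1 := h hγ
    have h2 := lt_min (hfa γ hγ) (hfb γ hγ)
    have h3 := add_pos (hfa γ hγ) (hfb γ hγ)
    have h4 : 0 < (min (fa γ) (fb γ)) ^ ((q i : ℝ) + 2 * a i) / (fa γ + fb γ) ^ (q i) := by
      positivity
    simp only [Pi.zero_apply, ENNReal.ofReal_eq_zero] at h1
    linarith
  exact hfalse.exists.elim fun _ h => h

theorem condD_of_marginalLikelihood_lt_top (hΓ : MeasurableSet Γ) (hfa : ∀ γ ∈ Γ, 0 < fa γ)
    (hfb : ∀ γ ∈ Γ, 0 < fb γ) (hca : ContinuousOn fa Γ) (hcb : ContinuousOn fb Γ)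
    [∀ i, IsProbabilityMeasure (prior i)] {M : ℝ} (hM : ∀ γ ∈ Γ, min (fa γ) (fb γ) < M)
    (hA : CondA a b) (h : marginalLikelihood X Z Γ fa fb prior a₀ b₀ a b y < ∞) :
    CondD q Γ fa fb prior a := by
  obtain ⟨c, hc, hle⟩ := exists_marginalLikelihood_ge X Z (a₀ := a₀) (b₀ := b₀) (prior := prior)
    hΓ hfa hfb hca hcb hM hA y
  exact ENNReal.lt_top_of_mul_ne_top_right (hle.trans_lt h).ne hc

/-- Otherwise the integrand is infinite on all of Γ^r, a set of full prior mass. A single good γ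
suffices for the conditions that do not involve the prior of γ. -/
theorem exists_conditionalMarginal_lt_top (hΓ : MeasurableSet Γ)
    [∀ i, IsProbabilityMeasure (prior i)] (hprior : ∀ i, prior i Γᶜ = 0)
    (h : marginalLikelihood X Z Γ fa fb prior a₀ b₀ a b y < ∞) :
    ∃ γ : Fin r → ℝ, (∀ i, γ i ∈ Γ) ∧ conditionalMarginal X Z fa fb a₀ b₀ a b y γ < ∞ := by
  by_contra hcon
  push Not at hcon
  rw [marginalLikelihood_eq, setLIntegral_congr_fun (g := fun _ => ∞)
    (MeasurableSet.univ_pi fun _ => hΓ)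
    (fun γ hγ => top_le_iff.1 (hcon γ fun i => hγ i (mem_univ i))), setLIntegral_const,
    Measure.pi_pi] at h
  simp [(prob_compl_eq_zero_iff hΓ).1 (hprior _)] at h

/-! ### Necessity of (b2) for a single block. -/

/-- Volume of a set of random effects that is long in the directions that the other columns
absorb. -/
theorem volume_sheared_box {ι : Type*} [Fintype ι] (B : ι → Prop) [DecidablePred B]
    (R : ({k // ¬ B k} → ℝ) →ₗ[ℝ] ({k // B k} → ℝ)) {s t : ℝ} (hs : 0 ≤ s) (ht : 0 ≤ t) :
    MeasurableSet {u : ι → ℝ | ‖fun k : {k // ¬ B k} => u k‖ ≤ s ∧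
      ‖(fun k : {k // B k} => u k) + R (fun k => u k)‖ ≤ t} ∧
    volume {u : ι → ℝ | ‖fun k : {k // ¬ B k} => u k‖ ≤ s ∧
      ‖(fun k : {k // B k} => u k) + R (fun k => u k)‖ ≤ t} =
    ENNReal.ofReal ((2 * t) ^ Fintype.card {k // B k}) *
      ENNReal.ofReal ((2 * s) ^ Fintype.card {k // ¬ B k}) := by
  set F : Set (({k // B k} → ℝ) × ({k // ¬ B k} → ℝ)) := {x | ‖x.2‖ ≤ s ∧ ‖x.1 + R x.2‖ ≤ t}
    with hF
  have hR : Continuous R := R.continuous_of_finiteDimensional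
  have hFm : MeasurableSet F :=
    (measurableSet_le (f := fun x : ({k // B k} → ℝ) × ({k // ¬ B k} → ℝ) => ‖x.2‖)
      (by fun_prop) measurable_const).inter
      (measurableSet_le (f := fun x : ({k // B k} → ℝ) × ({k // ¬ B k} → ℝ) => ‖x.1 + R x.2‖)
        (continuous_fst.add (hR.comp continuous_snd)).norm.measurable measurable_const)
  have hpre : {u : ι → ℝ | ‖fun k : {k // ¬ B k} => u k‖ ≤ s ∧
      ‖(fun k : {k // B k} => u k) + R (fun k => u k)‖ ≤ t} =
      MeasurableEquiv.piEquivPiSubtypeProd (fun _ : ι => ℝ) B ⁻¹' F := rfl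
  rw [hpre]
  refine ⟨(MeasurableEquiv.measurable _) hFm, ?_⟩
  rw [(volume_preserving_piEquivPiSubtypeProd (fun _ : ι => ℝ) B).measure_preimage_equiv,
    Measure.volume_eq_prod, Measure.prod_apply_symm hFm]
  -- Each slice is a ball of radius t centred at -R b; the shear moves it without changing its
  -- volume.
  have hsec : ∀ b : {k // ¬ B k} → ℝ, volume ((fun a => (a, b)) ⁻¹' F) =
      (Metric.closedBall (0 : {k // ¬ B k} → ℝ) s).indicator
        (fun _ => ENNReal.ofReal ((2 * t) ^ Fintype.card {k // B k})) b := by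
    intro b
    by_cases hb : b ∈ Metric.closedBall (0 : {k // ¬ B k} → ℝ) s
    · rw [indicator_of_mem hb, ← Real.volume_pi_closedBall (-R b) ht]
      congr 1
      ext a
      rw [mem_closedBall_zero_iff] at hb
      simp [hF, hb, dist_eq_norm]
    · rw [indicator_of_notMem hb]
      rw [mem_closedBall_zero_iff] at hb
      simp [hF, hb]
  simp_rw [hsec]
  rw [lintegral_indicator Metric.isClosed_closedBall.measurableSet, setLIntegral_const,
    Real.volume_pi_closedBall _ hs]

/-- The q - t coordinates outside B range over lengths of order σ, while those in B and the fixed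
effects cancel their contribution to Zu up to a bounded error. The kernel σ^(-q + (q - t) - 2a - 1)
must then be integrable at infinity. -/
theorem condB2_of_conditionalMarginal_lt_top (hX : X.rank = p) (hr : r = 1) {γ : Fin r → ℝ}
    (ha : ∀ i, 0 < fa (γ i)) (hb : ∀ i, 0 < fb (γ i))
    (h : conditionalMarginal X Z fa fb a₀ b₀ a b y γ < ∞) :
    CondB2 q (residualRank X Z) a := by
  subst hr
  obtain ⟨B, hBdec, hcard, hinj, hcol⟩ := exists_complementary_columns Z hX
  obtain ⟨g, R, hZ⟩ := exists_linear_completion hinj hcol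
  obtain ⟨c, C, hc, hC, hK⟩ := exists_lintegral_likelihood_ge X Z y
  obtain ⟨D, hD, hBD⟩ :=
    (Z.submatrix id (Subtype.val : {k // B k} → REIndex q)).mulVecLin.exists_norm_le
  obtain ⟨K, hK0, hRK⟩ := R.exists_norm_le
  set m := min (fa (γ 0)) (fb (γ 0)) with hm
  set H := fa (γ 0) + fb (γ 0) with hH
  have hm0 : 0 < m := lt_min (ha 0) (hb 0)
  have hH0 : 0 < H := add_pos (ha 0) (hb 0)
  -- For σ > 1 the coordinates in B are at most δ + Kδσ ≤ δ(1 + K)σ = σm, so the sheared box stays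
  -- where the two-piece density is bounded below.
  set δ : ℝ := m / (1 + K) with hδ
  have hδ0 : 0 < δ := by positivity
  have hδK : δ * (1 + K) = m := div_mul_cancel₀ _ (by positivity)
  set t := Fintype.card {k // B k} with ht
  set d := Fintype.card {k // ¬ B k} with hd
  have htd : t + d = q 0 := by
    have h3 := Fintype.card_subtype_compl B
    have h5 := Fintype.card_subtype_le B
    have h6 : Fintype.card (REIndex q) = q 0 := by simp
    omega
  set A : ℝ := H⁻¹ ^ q 0 * ((2 * δ) ^ t * (2 * δ) ^ d) with hA
  have hA0 : 0 < A := by positivity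
  set W : ℝ → ℝ := fun σ₀ => c * σ₀⁻¹ ^ n *
    Real.exp (-(C * (1 + D * δ) ^ 2) / (2 * σ₀ ^ 2)) * (D * δ) ^ p * scalePrior a₀ b₀ σ₀ with hW
  have hWpos : ∀ σ₀, 0 < σ₀ → 0 < W σ₀ := fun σ₀ hσ₀ => by
    have := scalePrior_pos (a := a₀) (b := b₀) hσ₀
    positivity
  have hWm : Measurable W := by
    have := measurable_scalePrior a₀ b₀
    fun_prop
  have hge := conditionalMarginal_ge_of_separable X Z (fa := fa) (fb := fb) (a₀ := a₀) (b₀ := b₀)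
    (a := a) (b := b) (y := y) (γ := γ) (W := W)
    (V := fun i σ => A * (σ⁻¹ ^ q 0 * σ ^ d * scalePrior (a i) (b i) σ))
    (fun i => by
      have := measurable_scalePrior (a i) (b i)
      fun_prop) (fun _ => Ioi 1) (fun _ => measurableSet_Ioi)
    (fun _ => Ioi_subset_Ioi zero_le_one) fun σ hσ σ₀ hσ₀ => ?_
  · have h1 := ENNReal.lt_top_of_mul_ne_top_right (hge.trans_lt h).ne
      (setLIntegral_Ioi_ofReal_pos hWm hWpos).ne'
    rw [Fin.prod_univ_one] at h1
    have hpos : 0 < A * Real.exp (-|b 0|) := by positivity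
    have h2 : ∫⁻ σ in Ioi (1 : ℝ),
        ENNReal.ofReal (σ ^ (-(q 0 : ℝ) + d + -(2 * a 0 + 1))) < ∞ := by
      refine ENNReal.lt_top_of_mul_ne_top_right
        (a := ENNReal.ofReal (A * Real.exp (-|b 0|))) (lt_of_le_of_lt ?_ h1).ne
        (by simpa using hpos)
      rw [← lintegral_const_mul' _ _ ENNReal.ofReal_ne_top]
      refine setLIntegral_mono' measurableSet_Ioi fun σ hσ => ?_
      have hσ1 : 1 < σ := hσ
      have hσ0 : 0 < σ := one_pos.trans hσ1
      rw [← ENNReal.ofReal_mul hpos.le]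
      refine ENNReal.ofReal_le_ofReal ?_
      calc _ = A * (σ⁻¹ ^ q 0 * σ ^ d * (Real.exp (-|b 0|) * σ ^ (-(2 * a 0 + 1)))) := by
            rw [Real.rpow_add hσ0, Real.rpow_add hσ0, Real.rpow_neg hσ0.le, Real.rpow_natCast,
              Real.rpow_natCast, inv_pow]
            ring
        _ ≤ _ := by
            gcongr
            exact scalePrior_ge hσ1.le
    rw [lintegral_Ioi_rpow_lt_top_iff one_pos] at h2
    have htd' : (t : ℝ) + d = q 0 := by exact_mod_cast htd
    have hres : residualRank X Z = t := hcard.symm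
    intro i
    rw [Subsingleton.elim i 0, hres]
    simp only [Fin.sum_univ_one, Fin.isValue]
    linarith
  · have hσ1 : 1 < σ 0 := hσ 0
    have hσ0 : 0 < σ 0 := one_pos.trans hσ1
    have hσpos : ∀ i, 0 < σ i := fun i => one_pos.trans (hσ i)
    have hw : 0 ≤ scalePrior a₀ b₀ σ₀ * ∏ i, scalePrior (a i) (b i) (σ i) :=
      mul_nonneg (scalePrior_nonneg hσ₀)
        (Finset.prod_nonneg fun i _ => scalePrior_nonneg (hσpos i))
    obtain ⟨hEm, hEv⟩ := volume_sheared_box B R (s := δ * σ 0) (t := δ) (by positivity) hδ0.le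
    refine le_trans ?_ (hK fa fb σ γ σ₀ (D * δ) _ (fun u => g fun k => u k) _ hσpos ha hb hσ₀
      (by positivity) hw hEm (fun u hu => ?_) fun u hu i k => ?_)
    · rw [hEv, Fin.prod_univ_one, Fin.prod_univ_one, Fin.prod_univ_one,
        ← ENNReal.ofReal_mul (hWpos σ₀ hσ₀).le, ← ENNReal.ofReal_mul (by positivity)]
      have h1 : 0 ≤ scalePrior a₀ b₀ σ₀ * scalePrior (a 0) (b 0) (σ 0) :=
        mul_nonneg (scalePrior_nonneg hσ₀) (scalePrior_nonneg hσ0)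
      rw [← ENNReal.ofReal_mul (by positivity)]
      refine ENNReal.ofReal_le_ofReal (le_of_eq ?_)
      simp only [hW, hA, mul_inv, mul_pow]
      ring
    · rw [hZ u, add_sub_cancel_left]
      refine (hBD _).trans ?_
      gcongr
      exact hu.2
    · obtain rfl : i = 0 := Subsingleton.elim _ _
      obtain ⟨hu1, hu2⟩ := hu
      have hδσ : δ * σ 0 ≤ σ 0 * m := by
        rw [← hδK]
        nlinarith [mul_pos hδ0 (mul_pos hK0 hσ0)]
      by_cases hk : B ⟨0, k⟩
      · have h1 : |u ⟨0, k⟩| ≤ ‖fun k : {k // B k} => u k‖ :=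
          norm_le_pi_norm (fun k : {k // B k} => u k) ⟨⟨0, k⟩, hk⟩
        have h2 : ‖fun k : {k // B k} => u k‖ ≤ δ + K * (δ * σ 0) := by
          have e : (fun k : {k // B k} => u k) =
              ((fun k : {k // B k} => u k) + R (fun k => u k)) - R (fun k => u k) := by abel
          rw [e]
          refine (norm_sub_le _ _).trans (add_le_add hu2 ((hRK _).trans ?_))
          gcongr
        refine (h1.trans h2).trans ?_
        change _ ≤ σ 0 * m
        rw [← hδK]
        nlinarith
      · have h1 : |u ⟨0, k⟩| ≤ ‖fun k : {k // ¬ B k} => u k‖ :=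
          norm_le_pi_norm (fun k : {k // ¬ B k} => u k) ⟨⟨0, k⟩, hk⟩
        exact (h1.trans hu1).trans hδσ

end LowerBound

/-! ### Assembly of the two cases. -/

theorem theorem1 {n p r : ℕ} (q : Fin r → ℕ) (hq : ∀ i, 0 < q i)
    (X : Matrix (Fin n) (Fin p) ℝ) (Z : Matrix (Fin n) (REIndex q) ℝ)
    (hX : X.rank = p) (hpn : p < n)
    (Γ : Set ℝ) (hΓ : MeasurableSet Γ) (fa fb : ℝ → ℝ)
    (hfa : ∀ γ ∈ Γ, 0 < fa γ) (hfb : ∀ γ ∈ Γ, 0 < fb γ)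
    (hfa' : DifferentiableOn ℝ fa Γ) (hfb' : DifferentiableOn ℝ fb Γ)
    (prior : Fin r → Measure ℝ) (hprior : ∀ i, IsProbabilityMeasure (prior i))
    (hpriorΓ : ∀ i, prior i Γᶜ = 0)
    (hm : ∃ m : ℝ, 0 < m ∧ ∀ γ ∈ Γ, min (fa γ) (fb γ) < m)
    (hM : ∃ M : ℝ, 0 < M ∧ ∀ γ ∈ Γ, M < fa γ + fb γ)
    (a₀ b₀ : ℝ) (a b : Fin r → ℝ) :
    -- first case: `t = q` or `r = 1`
    ((residualRank X Z = ∑ i, q i ∨ r = 1) →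
      (∀ y : Fin n → ℝ, ProperPosterior X Z Γ fa fb prior a₀ b₀ a b y →
        CondA a b ∧ CondB2 q (residualRank X Z) a ∧ CondC1 n p a₀ a ∧
          CondD q Γ fa fb prior a) ∧
      (CondA a b ∧ CondB2 q (residualRank X Z) a ∧ CondC2 n p a₀ a ∧
          CondE Γ fa fb prior a →
        ∀ y : Fin n → ℝ, 0 < 2 * b₀ + SSE X Z y →
          ProperPosterior X Z Γ fa fb prior a₀ b₀ a b y)) ∧
    -- second case: `t < q` and `r > 1`
    ((residualRank X Z < ∑ i, q i ∧ 1 < r) →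
      (∀ y : Fin n → ℝ, ProperPosterior X Z Γ fa fb prior a₀ b₀ a b y →
        CondA a b ∧ CondB1 q a ∧ CondC1 n p a₀ a ∧ CondD q Γ fa fb prior a) ∧
      (CondA a b ∧ CondB2 q (residualRank X Z) a ∧ CondC2 n p a₀ a ∧
          CondE Γ fa fb prior a →
        ∀ y : Fin n → ℝ, 0 < 2 * b₀ + SSE X Z y →
          ProperPosterior X Z Γ fa fb prior a₀ b₀ a b y)) ∧
    -- the condition on the sample holds almost surely
    ((0 < b₀ ∨ (b₀ = 0 ∧ (Matrix.fromCols X Z).rank < n)) →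
      ∀ᵐ y : Fin n → ℝ, 0 < 2 * b₀ + SSE X Z y) := by
  obtain ⟨m, -, hm⟩ := hm
  obtain ⟨M, hM0, hM⟩ := hM
  have hca := hfa'.continuousOn
  have hcb := hfb'.continuousOn
  have hsuff : CondA a b ∧ CondB2 q (residualRank X Z) a ∧ CondC2 n p a₀ a ∧
      CondE Γ fa fb prior a → ∀ y : Fin n → ℝ, 0 < 2 * b₀ + SSE X Z y →
        ProperPosterior X Z Γ fa fb prior a₀ b₀ a b y := fun ⟨hA, hB, hC, hE⟩ y hy =>
    ⟨marginalLikelihood_pos X Z hΓ hfa hfb hca hcb hpriorΓ hm hA y,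
      marginalLikelihood_lt_top X Z hX hΓ hfa hfb hca hcb hM0 hM hA hB hC hE hy⟩
  have hnec : ∀ y : Fin n → ℝ, ProperPosterior X Z Γ fa fb prior a₀ b₀ a b y →
      CondA a b ∧ CondB1 q a ∧ (r = 1 → CondB2 q (residualRank X Z) a) ∧ CondC1 n p a₀ a ∧
        CondD q Γ fa fb prior a := by
    intro y hy
    obtain ⟨γ, hγ, hlt⟩ := exists_conditionalMarginal_lt_top X Z hΓ hpriorΓ hy.2
    have ha0 : ∀ i, 0 < fa (γ i) := fun i => hfa _ (hγ i)
    have hb0 : ∀ i, 0 < fb (γ i) := fun i => hfb _ (hγ i)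
    have hA := condA_of_conditionalMarginal_lt_top X Z ha0 hb0 hlt
    exact ⟨hA, condB1_of_conditionalMarginal_lt_top X Z ha0 hb0 hlt,
      fun hr => condB2_of_conditionalMarginal_lt_top X Z hX hr ha0 hb0 hlt,
      condC1_of_conditionalMarginal_lt_top X Z ha0 hb0 hlt,
      condD_of_marginalLikelihood_lt_top X Z hΓ hfa hfb hca hcb hm hA hy.2⟩
  refine ⟨fun hcase => ⟨fun y hy => ?_, hsuff⟩, fun _ => ⟨fun y hy => ?_, hsuff⟩, ?_⟩
  · obtain ⟨hA, hB1, hB2, hC, hD⟩ := hnec y hy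
    refine ⟨hA, ?_, hC, hD⟩
    -- For t = q the right-hand deficit q - t vanishes and (b2) is (b1); for r = 1 the sheared box
    -- applies.
    rcases hcase with ht | hr
    · intro i
      rw [ht, sub_self]
      exact hB1 i
    · exact hB2 hr
  · obtain ⟨hA, hB1, -, hC, hD⟩ := hnec y hy
    exact ⟨hA, hB1, hC, hD⟩
  · rintro (hb | ⟨hb, hrank⟩)
    · exact .of_forall fun y => by linarith [SSE_nonneg X Z y]
    · filter_upwards [ae_SSE_pos X Z hrank] with y hy
      rw [hb]
      linarith
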